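/- Let $m,n$ be integers with $1<m\le n$. Let $F=\mathbb C(x_1,\dots,x_n,y_1,\dots,y_n)$ be the field of rational functions in $2n$ variables. The triplet-pair system $F_I$ on two triplets $a_0,a_1,a_2$ and $b_0,b_1,b_2$ consists of the two equations $$(1-a_0)(1-a_1)(1-a_2)=(1-b_0)(1-b_1)(1-b_2),\qquad a_0a_1a_2=b_0b_1b_2 .$$ For $j\in\{1,\dots,n\}$ and $i\neq j$, imposing $F_I$ on the triplets $y_j,x_i,\bar x_i$ and $x_j,y_i,\bar y_i$ determines $\bar x_i,\bar y_i\in F$ uniquely. Let $\sigma_j$ be the birational map (automorphism of $F$ over $\mathbb C$) $\sigma_j=\{x_i\mapsto\bar x_i,\ i\ne j\}$, which leaves $x_j$ and all $y_i$ unaltered, let $\omega=\{x_i\leftrightarrow y_i,\ 1\le i\le n\}$, and put $$t_1=\omega,\quad t_2=\sigma_1\omega\sigma_1,\quad t_3=\omega\sigma_1\sigma_2\omega\sigma_2\sigma_1\omega,\quad t_{i+3}=(\omega\sigma_i\sigma_{i+1})^3\quad(1\le i\le m-1).$$ Let $[u]$ be one of the following: the Weierstrass sigma function $\sigma(u)$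 of an arbitrary period lattice in $\mathbb C$, or $\sinh u$, or $u$. For parameters $p=(h_1,h_2,k_1,\dots,k_{n+3})\in\mathbb C^{n+5}$ put $$c_{i,j}=[k_i-k_j][h_1-k_i-k_j],\qquad d_{i,j}=[k_i-k_j][h_2-k_i-k_j],$$ and consider the substitution $$x_i=\frac{c_{1,3}\,c_{2,i+3}}{c_{2,3}\,c_{1,i+3}},\qquad y_i=\frac{d_{1,3}\,d_{2,i+3}}{d_{2,3}\,d_{1,i+3}}\qquad(1\le i\le n),$$ which defines a point $\Phi(p)\in\mathbb C^{2n}$ for every $p$ at which none of the denominators vanishes. **Theorem.** Under this substitution the actions of $t_1,\dots,t_{m+2}$ on $(x_i,y_i)_{i=1,\dots,n}$ are compatible with the following linear actions $T_1,\dots,T_{m+2}$ on the parameters (parameters that are not listed are unchanged): $$\begin{aligned} T_1&=\{h_1\leftrightarrow h_2\},\\ T_2&=\{h_i\mapsto h_i+\beta\ (i=1,2),\ k_i\mapsto k_i+\beta\ (i\le 4)\},\qquad \beta=h_1+h_2-k_1-k_2-k_3-k_4,\\ T_3&=\{h_1\mapsto h_1+h_2-k_4-k_5,\ k_4\mapsto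 h_2-k_5,\ k_5\mapsto h_2-k_4\},\\ T_j&=\{k_j\leftrightarrow k_{j+1}\}\qquad(4\le j\le m+2). \end{aligned}$$ Here compatibility means the following, for each $j\in\{1,\dots,m+2\}$. There is a dense open set of $p\in\mathbb C^{n+5}$ for which $\Phi(p)$ and $\Phi(T_jp)$ are defined and all the rational functions $t_j(x_i),t_j(y_i)\in F$ are regular at $\Phi(p)$. Moreover, for every $p$ such that $\Phi(p)$ and $\Phi(T_jp)$ are defined and for every variable $v\in\{x_1,\dots,x_n,y_1,\dots,y_n\}$ such that $t_j(v)$ is regular at $\Phi(p)$, the value of $t_j(v)$ at $\Phi(p)$ is the $v$-coordinate of $\Phi(T_jp)$. -/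

import Mathlib

namespace TripletPair

noncomputable section

/-! ### The triplet-pair system -/

/-- The rational triplet-pair system `F_I` on the triplets `a` and `b`:
`(1-a₀)(1-a₁)(1-a₂) = (1-b₀)(1-b₁)(1-b₂)` and `a₀a₁a₂ = b₀b₁b₂`. -/
def SystemFI {K : Type*} [Field K] (a₀ a₁ a₂ b₀ b₁ b₂ : K) : Prop :=
  (1 - a₀) * (1 - a₁) * (1 - a₂) = (1 - b₀) * (1 - b₁) * (1 - b₂) ∧
    a₀ * a₁ * a₂ = b₀ * b₁ * b₂

/-- The common denominator in the solution of the system for `a₂, b₂`. -/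
def den {K : Type*} [Field K] (a₀ a₁ b₀ b₁ : K) : K :=
  (1 - b₀) * (1 - b₁) * (a₀ * a₁) - (1 - a₀) * (1 - a₁) * (b₀ * b₁)

/-- The value of `a₂` that the system determines from `a₀, a₁, b₀, b₁`. -/
def third {K : Type*} [Field K] (a₀ a₁ b₀ b₁ : K) : K :=
  b₀ * b₁ * ((1 - b₀) * (1 - b₁) - (1 - a₀) * (1 - a₁)) / den a₀ a₁ b₀ b₁

/-- The system rationally determines one variable of each triplet from the four others. -/
theorem systemFI_iff {K : Type*} [Field K] {a₀ a₁ b₀ b₁ : K} (h : den a₀ a₁ b₀ b₁ ≠ 0)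
    (a₂ b₂ : K) :
    SystemFI a₀ a₁ a₂ b₀ b₁ b₂ ↔ a₂ = third a₀ a₁ b₀ b₁ ∧ b₂ = third b₀ b₁ a₀ a₁ := by
  have h' : den b₀ b₁ a₀ a₁ ≠ 0 := by
    intro h0; apply h; unfold den at h0 ⊢; linear_combination -h0
  unfold SystemFI third
  rw [eq_div_iff h, eq_div_iff h']
  constructor
  · rintro ⟨h1, h2⟩
    unfold den
    constructor
    · linear_combination (1 - b₀) * (1 - b₁) * h2 + b₀ * b₁ * h1
    · linear_combination (-(1 - a₀) * (1 - a₁)) * h2 - a₀ * a₁ * h1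
  · rintro ⟨h1, h2⟩
    unfold den at h1 h2
    constructor
    · apply mul_left_cancel₀ h
      unfold den
      linear_combination (-(1 - a₀) * (1 - a₁)) * h1 - ((1 - b₀) * (1 - b₁)) * h2
    · apply mul_left_cancel₀ h
      unfold den
      linear_combination (a₀ * a₁) * h1 + (b₀ * b₁) * h2

/-! ### Rational maps of the variables `x_i, y_i` -/

/-- Index set of the `2n` variables: `Sum.inl i` stands for `x_{i+1}`,
`Sum.inr i` for `y_{i+1}`. -/
abbrev Vars (n : ℕ) : Type := Fin n ⊕ Fin n

/-- The polynomial ring `ℂ[x_1,…,x_n,y_1,…,y_n]`. -/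
abbrev Pol (n : ℕ) : Type := MvPolynomial (Vars n) ℂ

/-- The field of rational functions `ℂ(x_1,…,x_n,y_1,…,y_n)`. -/
abbrev RatFn (n : ℕ) : Type := FractionRing (Pol n)

/-- A variable, as a rational function. -/
def X {n : ℕ} (v : Vars n) : RatFn n := algebraMap (Pol n) (RatFn n) (MvPolynomial.X v)

/-- The variable `x_{i+1}`. -/
def x {n : ℕ} (i : Fin n) : RatFn n := X (Sum.inl i)

/-- The variable `y_{i+1}`. -/
def y {n : ℕ} (i : Fin n) : RatFn n := X (Sum.inr i)

theorem X_algebraicIndependent (n : ℕ) : AlgebraicIndependent ℂ (X : Vars n → RatFn n) := by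
  have h := (MvPolynomial.algebraicIndependent_X (Vars n) ℂ).map'
    (f := IsScalarTower.toAlgHom ℂ (Pol n) (RatFn n)) (IsFractionRing.injective (Pol n) (RatFn n))
  exact h

theorem adjoin_X_eq_top (n : ℕ) :
    IntermediateField.adjoin ℂ (Set.range (X : Vars n → RatFn n)) = ⊤ := by
  rw [eq_top_iff]
  intro f _
  obtain ⟨p, q, _, rfl⟩ := IsFractionRing.div_surjective (A := Pol n) f
  have key : ∀ p : Pol n, algebraMap (Pol n) (RatFn n) p ∈
      IntermediateField.adjoin ℂ (Set.range (X : Vars n → RatFn n)) := by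
    intro p
    induction p using MvPolynomial.induction_on with
    | C a =>
      have : algebraMap (Pol n) (RatFn n) (MvPolynomial.C a) = algebraMap ℂ (RatFn n) a :=
        (IsScalarTower.algebraMap_apply ℂ (Pol n) (RatFn n) a).symm
      rw [this]
      exact IntermediateField.algebraMap_mem _ a
    | add p q hp hq => rw [map_add]; exact add_mem hp hq
    | mul_X p v hp =>
      rw [map_mul]
      exact mul_mem hp (IntermediateField.subset_adjoin _ _ ⟨v, rfl⟩)
  exact div_mem (key p) (key q)

/-- A tuple of rational functions in terms of which all the variables can be expressed
rationally is algebraically independent, so that it can be substituted in any rational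
function. -/
theorem algebraicIndependent_of_generates {n : ℕ} (v : Vars n → RatFn n)
    (hv : ∀ a, X a ∈ IntermediateField.adjoin ℂ (Set.range v)) : AlgebraicIndependent ℂ v := by
  have htop : IntermediateField.adjoin ℂ (Set.range v) = ⊤ := by
    rw [eq_top_iff, ← adjoin_X_eq_top, IntermediateField.adjoin_le_iff]
    rintro _ ⟨a, rfl⟩
    exact hv a
  have : Algebra.IsAlgebraic (Algebra.adjoin ℂ (Set.range v)) (RatFn n) := by
    constructor
    intro f
    have hf : f ∈ IntermediateField.adjoin ℂ (Set.range v) := htop ▸ IntermediateField.mem_top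
    rw [IntermediateField.mem_adjoin_iff_div] at hf
    obtain ⟨r, hr, s, hs, rfl⟩ := hf
    rw [div_eq_mul_inv]
    exact (isAlgebraic_algebraMap (⟨r, hr⟩ : Algebra.adjoin ℂ (Set.range v))).mul
      (isAlgebraic_algebraMap (⟨s, hs⟩ : Algebra.adjoin ℂ (Set.range v))).inv
  exact (Algebra.IsAlgebraic.isTranscendenceBasis_of_le_trdeg_of_finite ℂ v
    (X_algebraicIndependent n).cardinalMk_le_trdeg).1

/-- The substitution `{X a ↦ v a}` of the rational functions `v a` for the variables. -/
def subst {n : ℕ} (v : Vars n → RatFn n)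
    (hv : ∀ a, X a ∈ IntermediateField.adjoin ℂ (Set.range v)) : RatFn n →ₐ[ℂ] RatFn n :=
  IsFractionRing.liftAlgHom (g := MvPolynomial.aeval (R := ℂ) v)
    (algebraicIndependent_of_generates v hv)

theorem subst_X {n : ℕ} (v : Vars n → RatFn n)
    (hv : ∀ a, X a ∈ IntermediateField.adjoin ℂ (Set.range v)) (a : Vars n) :
    subst v hv (X a) = v a := by
  have h := IsFractionRing.lift_algebraMap (K := RatFn n)
    (g := (MvPolynomial.aeval (R := ℂ) v : Pol n →ₐ[ℂ] RatFn n).toRingHom)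
    (algebraicIndependent_of_generates v hv) (MvPolynomial.X a)
  exact h.trans (MvPolynomial.aeval_X v a)

theorem algHom_ext_X {n : ℕ} {f g : RatFn n →ₐ[ℂ] RatFn n} (h : ∀ a, f (X a) = g (X a)) :
    f = g := by
  apply IsLocalization.algHom_ext (nonZeroDivisors (Pol n))
  apply MvPolynomial.algHom_ext
  intro a
  exact h a

theorem X_injective (n : ℕ) : Function.Injective (X : Vars n → RatFn n) :=
  (X_algebraicIndependent n).injective

theorem X_ne_zero {n : ℕ} (a : Vars n) : X a ≠ 0 := (X_algebraicIndependent n).ne_zero a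

theorem one_sub_X_ne_zero {n : ℕ} (a : Vars n) : 1 - X a ≠ 0 := by
  have h : (1 - MvPolynomial.X a : Pol n) ≠ 0 := by
    intro h
    simpa using congrArg (MvPolynomial.eval (fun _ => (0 : ℂ))) h
  have h2 := (map_ne_zero_iff _ (IsFractionRing.injective (Pol n) (RatFn n))).2 h
  simpa [X] using h2

theorem den_ne_zero {n : ℕ} {i j : Fin n} (h : i ≠ j) : den (y j) (x i) (x j) (y i) ≠ 0 := by
  have h1 : ((1 - MvPolynomial.X (Sum.inl j)) * (1 - MvPolynomial.X (Sum.inr i)) *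
      (MvPolynomial.X (Sum.inr j) * MvPolynomial.X (Sum.inl i)) -
      (1 - MvPolynomial.X (Sum.inr j)) * (1 - MvPolynomial.X (Sum.inl i)) *
      (MvPolynomial.X (Sum.inl j) * MvPolynomial.X (Sum.inr i)) : Pol n) ≠ 0 := by
    intro h0
    have := congrArg (MvPolynomial.eval
      (Sum.elim (fun k => if k = i then (1 : ℂ) else 0) (fun k => if k = j then 1 else 0))) h0
    simp [h, h.symm] at this
  have h2 := (map_ne_zero_iff _ (IsFractionRing.injective (Pol n) (RatFn n))).2 h1
  simpa [X, x, y, den] using h2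

/-! ### The birational maps `σ_j`, `ω` and `t_1, …, t_{m+2}` -/

/-- `x̄_i`, for the map `σ_j`: it is determined by imposing the system on
`y_j, x_i, x̄_i` and `x_j, y_i, ȳ_i` when `i ≠ j`, and `x̄_j = x_j`. -/
def xbar {n : ℕ} (j i : Fin n) : RatFn n :=
  if i = j then x i else third (y j) (x i) (x j) (y i)

/-- `ȳ_i`, for the map `σ_j`. -/
def ybar {n : ℕ} (j i : Fin n) : RatFn n :=
  if i = j then y i else third (x j) (y i) (y j) (x i)

/-- `x̄_i` and `ȳ_i` are exactly what the imposed system determines. -/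
theorem systemFI_iff_bar {n : ℕ} {j i : Fin n} (h : i ≠ j) (a b : RatFn n) :
    SystemFI (y j) (x i) a (x j) (y i) b ↔ a = xbar j i ∧ b = ybar j i := by
  rw [systemFI_iff (den_ne_zero h), xbar, ybar, if_neg h, if_neg h]

/-- The images of the variables under `σ_j`. -/
def sigmaVal {n : ℕ} (j : Fin n) : Vars n → RatFn n
  | Sum.inl i => xbar j i
  | Sum.inr i => y i

theorem den_xbar_ne_zero {n : ℕ} {i j : Fin n} (h : i ≠ j) :
    den (y j) (xbar j i) (x j) (y i) ≠ 0 := by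
  have hd := den_ne_zero h
  have e : den (y j) (xbar j i) (x j) (y i) * den (y j) (x i) (x j) (y i) =
      x j * y i * (1 - x j) * (1 - y i) * (y j - x j) * (y j - y i) := by
    have hx : xbar j i * den (y j) (x i) (x j) (y i) = x j * y i *
        ((1 - x j) * (1 - y i) - (1 - y j) * (1 - x i)) := by
      rw [xbar, if_neg h, third, div_mul_cancel₀ _ hd]
    have : den (y j) (xbar j i) (x j) (y i) =
        xbar j i * ((1 - x j) * (1 - y i) * y j + (1 - y j) * (x j * y i)) -
          (1 - y j) * (x j * y i) := by
      unfold den; ring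
    rw [this, sub_mul, mul_right_comm, hx]
    unfold den
    ring
  intro h0
  rw [h0, zero_mul] at e
  have h1 : y j - x j ≠ 0 := sub_ne_zero.2 fun h => by simpa using X_injective n h
  have h2 : y j - y i ≠ 0 := sub_ne_zero.2 fun h' => by
    have := X_injective n h'
    simp at this
    exact h this.symm
  exact (mul_ne_zero (mul_ne_zero (mul_ne_zero (mul_ne_zero (mul_ne_zero (X_ne_zero _)
    (X_ne_zero _)) (one_sub_X_ne_zero _)) (one_sub_X_ne_zero _)) h1) h2) e.symm

/-- The relation that shows that `σ_j` is an involution. -/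
theorem third_xbar {n : ℕ} {i j : Fin n} (h : i ≠ j) :
    third (y j) (xbar j i) (x j) (y i) = x i := by
  obtain ⟨h1, h2⟩ := (systemFI_iff_bar h _ _).2 ⟨rfl, rfl⟩
  refine (((systemFI_iff (den_xbar_ne_zero h) (x i) (ybar j i)).1 ⟨?_, ?_⟩).1).symm
  · rw [mul_right_comm]; exact h1
  · rw [mul_right_comm]; exact h2

theorem third_mem {n : ℕ} {L : IntermediateField ℂ (RatFn n)} {a b c d : RatFn n}
    (ha : a ∈ L) (hb : b ∈ L) (hc : c ∈ L) (hd : d ∈ L) : third a b c d ∈ L := by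
  have h1 : ∀ {a}, a ∈ L → 1 - a ∈ L := fun h => sub_mem (one_mem L) h
  unfold third den
  exact div_mem (mul_mem (mul_mem hc hd) (sub_mem (mul_mem (h1 hc) (h1 hd))
    (mul_mem (h1 ha) (h1 hb)))) (sub_mem (mul_mem (mul_mem (h1 hc) (h1 hd)) (mul_mem ha hb))
    (mul_mem (mul_mem (h1 ha) (h1 hb)) (mul_mem hc hd)))

theorem sigmaVal_generates {n : ℕ} (j : Fin n) (a : Vars n) :
    X a ∈ IntermediateField.adjoin ℂ (Set.range (sigmaVal j)) := by
  have hm : ∀ b, sigmaVal j b ∈ IntermediateField.adjoin ℂ (Set.range (sigmaVal j)) :=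
    fun b => IntermediateField.subset_adjoin _ _ ⟨b, rfl⟩
  rcases a with i | i
  · have hj : x j ∈ IntermediateField.adjoin ℂ (Set.range (sigmaVal j)) := by
      have := hm (Sum.inl j)
      rwa [sigmaVal, xbar, if_pos rfl] at this
    by_cases h : i = j
    · subst h; exact hj
    · change x i ∈ _
      rw [← third_xbar h]
      exact third_mem (hm (Sum.inr j)) (hm (Sum.inl i)) hj (hm (Sum.inr i))
  · exact hm (Sum.inr i)

/-- The substitution `{x_i ↦ x̄_i, i ≠ j}`, as an endomorphism. -/
def sigmaHom {n : ℕ} (j : Fin n) : RatFn n →ₐ[ℂ] RatFn n :=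
  subst (sigmaVal j) (sigmaVal_generates j)

theorem sigmaHom_x {n : ℕ} (j i : Fin n) : sigmaHom j (x i) = xbar j i := subst_X _ _ _

theorem sigmaHom_y {n : ℕ} (j i : Fin n) : sigmaHom j (y i) = y i := subst_X _ _ _

theorem sigmaHom_comp_self {n : ℕ} (j : Fin n) :
    (sigmaHom j).comp (sigmaHom j) = AlgHom.id ℂ (RatFn n) := by
  apply algHom_ext_X
  rintro (i | i)
  · change sigmaHom j (sigmaHom j (x i)) = x i
    rw [sigmaHom_x]
    by_cases h : i = j
    · subst h
      rw [xbar, if_pos rfl, sigmaHom_x, xbar, if_pos rfl]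
    · have hj : sigmaHom j (x j) = x j := by rw [sigmaHom_x, xbar, if_pos rfl]
      conv_rhs => rw [← third_xbar h]
      conv_lhs => rw [xbar, if_neg h]
      simp only [third, den, map_div₀, map_mul, map_sub, map_one, hj, sigmaHom_y, sigmaHom_x]
  · change sigmaHom j (sigmaHom j (y i)) = y i
    rw [sigmaHom_y, sigmaHom_y]

/-- The birational map `σ_j = {x_i ↦ x̄_i, i ≠ j}`, as an automorphism of the field of
rational functions. -/
def sigma {n : ℕ} (j : Fin n) : RatFn n ≃ₐ[ℂ] RatFn n :=
  AlgEquiv.ofAlgHom (sigmaHom j) (sigmaHom j) (sigmaHom_comp_self j) (sigmaHom_comp_self j)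

theorem sigma_x {n : ℕ} (j i : Fin n) : sigma j (x i) = xbar j i := sigmaHom_x j i

theorem sigma_y {n : ℕ} (j i : Fin n) : sigma j (y i) = y i := sigmaHom_y j i

theorem swap_generates {n : ℕ} (a : Vars n) :
    X a ∈ IntermediateField.adjoin ℂ (Set.range fun b : Vars n => X b.swap) :=
  IntermediateField.subset_adjoin _ _ ⟨a.swap, by simp⟩

/-- The substitution `{x_i ↔ y_i}`, as an endomorphism. -/
def omegaHom (n : ℕ) : RatFn n →ₐ[ℂ] RatFn n := subst (fun b => X b.swap) swap_generates

theorem omegaHom_X {n : ℕ} (a : Vars n) : omegaHom n (X a) = X a.swap := subst_X _ _ _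

theorem omegaHom_comp_self (n : ℕ) :
    (omegaHom n).comp (omegaHom n) = AlgHom.id ℂ (RatFn n) := by
  apply algHom_ext_X
  intro a
  change omegaHom n (omegaHom n (X a)) = X a
  rw [omegaHom_X, omegaHom_X, Sum.swap_swap]

/-- The map `ω = {x_i ↔ y_i}`. -/
def omega (n : ℕ) : RatFn n ≃ₐ[ℂ] RatFn n :=
  AlgEquiv.ofAlgHom (omegaHom n) (omegaHom n) (omegaHom_comp_self n) (omegaHom_comp_self n)

theorem omega_x {n : ℕ} (i : Fin n) : omega n (x i) = y i := omegaHom_X _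

theorem omega_y {n : ℕ} (i : Fin n) : omega n (y i) = x i := omegaHom_X _

/-- `t_1 = ω`. -/
def t₁ (n : ℕ) : RatFn n ≃ₐ[ℂ] RatFn n := omega n

/-- `t_2 = σ_1 ω σ_1`. -/
def t₂ (n : ℕ) (hn : 1 < n) : RatFn n ≃ₐ[ℂ] RatFn n :=
  sigma ⟨0, by omega⟩ * omega n * sigma ⟨0, by omega⟩

/-- `t_3 = ω σ_1 σ_2 ω σ_2 σ_1 ω`. -/
def t₃ (n : ℕ) (hn : 1 < n) : RatFn n ≃ₐ[ℂ] RatFn n :=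
  omega n * sigma ⟨0, by omega⟩ * sigma ⟨1, hn⟩ * omega n * sigma ⟨1, hn⟩ *
    sigma ⟨0, by omega⟩ * omega n

/-- `t_{i+3} = (ω σ_i σ_{i+1})^3`, for `1 ≤ i < n`. -/
def tAdd3 (n i : ℕ) (hi : 1 ≤ i) (hin : i < n) : RatFn n ≃ₐ[ℂ] RatFn n :=
  (omega n * sigma ⟨i - 1, by omega⟩ * sigma ⟨i, hin⟩) ^ 3

/-! ### The function `[u]` and the parametrization -/

/-- The Weierstrass sigma function of the lattice of `L`,
`σ(u) = u ∏_{ω ≠ 0} (1 - u/ω) exp(u/ω + u²/(2ω²))`. -/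
def weierstrassSigma (L : PeriodPair) (u : ℂ) : ℂ :=
  u * ∏' w : {w : ℂ // w ∈ L.lattice ∧ w ≠ 0},
    (1 - u / (w : ℂ)) * Complex.exp (u / (w : ℂ) + u ^ 2 / (2 * (w : ℂ) ^ 2))

/-- The three cases for the function `[u]`. -/
inductive Bracket : Type
  /-- elliptic case, with an arbitrary period lattice -/
  | elliptic (L : PeriodPair)
  /-- trigonometric case -/
  | trigonometric
  /-- rational case -/
  | rational

/-- The function `[u]`: `σ(u)`, `sinh u` or `u`. -/
def Bracket.fn : Bracket → ℂ → ℂ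
  | elliptic L => weierstrassSigma L
  | trigonometric => Complex.sinh
  | rational => fun u => u

/-- The space of the parameters `(h, k)`, with `h = (h_1, h_2)` and `k = (k_1, …, k_{n+3})`. -/
abbrev Params (n : ℕ) : Type := (Fin 2 → ℂ) × (Fin (n + 3) → ℂ)

/-- The parameter `h_a`, `a = 1, 2`. -/
def hh {n : ℕ} (p : Params n) (a : ℕ) (ha : 1 ≤ a ∧ a ≤ 2 := by omega) : ℂ :=
  p.1 ⟨a - 1, by omega⟩

/-- The parameter `k_i`, `1 ≤ i ≤ n + 3`. -/
def kk {n : ℕ} (p : Params n) (i : ℕ) (hi : 1 ≤ i ∧ i ≤ n + 3 := by omega) : ℂ :=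
  p.2 ⟨i - 1, by omega⟩

/-- `c_{i,j} = [k_i - k_j][h_1 - k_i - k_j]` for `a = 1`, and
`d_{i,j} = [k_i - k_j][h_2 - k_i - k_j]` for `a = 2`. -/
def coeff (br : Bracket) {n : ℕ} (p : Params n) (a i j : ℕ) (ha : 1 ≤ a ∧ a ≤ 2 := by omega)
    (hi : 1 ≤ i ∧ i ≤ n + 3 := by omega) (hj : 1 ≤ j ∧ j ≤ n + 3 := by omega) : ℂ :=
  br.fn (kk p i - kk p j) * br.fn (hh p a - kk p i - kk p j)

/-- The parametrization: `x_i = c_{1,3} c_{2,i+3} / (c_{2,3} c_{1,i+3})` and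
`y_i = d_{1,3} d_{2,i+3} / (d_{2,3} d_{1,i+3})`, for `1 ≤ i ≤ n`; an element `i : Fin n` stands for the index `i.val + 1`. -/
def param (br : Bracket) {n : ℕ} (p : Params n) : Vars n → ℂ
  | Sum.inl i => coeff br p 1 1 3 * coeff br p 1 2 (i.val + 4) /
      (coeff br p 1 2 3 * coeff br p 1 1 (i.val + 4))
  | Sum.inr i => coeff br p 2 1 3 * coeff br p 2 2 (i.val + 4) /
      (coeff br p 2 2 3 * coeff br p 2 1 (i.val + 4))

/-- The parameter values where no denominator in the parametrization vanishes. -/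
def Admissible (br : Bracket) {n : ℕ} (p : Params n) : Prop :=
  ∀ (a : ℕ) (ha : 1 ≤ a ∧ a ≤ 2),
    coeff br p a 2 3 ≠ 0 ∧ ∀ i : Fin n, coeff br p a 1 (i.val + 4) ≠ 0

/-! ### The linear actions -/

/-- `t_1 = {h_1 ↔ h_2}`. -/
def lin₁ (n : ℕ) : Params n →ₗ[ℂ] Params n where
  toFun p := (![hh p 2, hh p 1], p.2)
  map_add' p q := by
    ext i
    · fin_cases i <;> simp [hh]
    · rfl
  map_smul' c p := by
    ext i
    · fin_cases i <;> simp [hh]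
    · rfl

/-- `t_2 = {h_i ↦ h_i + β, k_{i≤4} ↦ k_i + β}`, `β = h_1 + h_2 - k_1 - k_2 - k_3 - k_4`. -/
def lin₂ (n : ℕ) (hn : 1 < n) : Params n →ₗ[ℂ] Params n where
  toFun p :=
    let β : ℂ := hh p 1 + hh p 2 - kk p 1 - kk p 2 - kk p 3 - kk p 4
    (fun i => p.1 i + β, fun i => if i.val + 1 ≤ 4 then p.2 i + β else p.2 i)
  map_add' p q := by
    ext i
    · simp [hh, kk]; ring
    · simp only [hh, kk, Prod.fst_add, Prod.snd_add, Pi.add_apply]; split_ifs <;> ring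
  map_smul' c p := by
    ext i
    · simp [hh, kk]; ring
    · simp only [hh, kk, Prod.smul_fst, Prod.smul_snd, Pi.smul_apply, smul_eq_mul,
        RingHom.id_apply]
      split_ifs <;> ring

/-- `t_3 = {h_1 ↦ h_1 + h_2 - k_4 - k_5, k_4 ↦ h_2 - k_5, k_5 ↦ h_2 - k_4}`. -/
def lin₃ (n : ℕ) (hn : 1 < n) : Params n →ₗ[ℂ] Params n where
  toFun p := (![hh p 1 + hh p 2 - kk p 4 - kk p 5, hh p 2],
    fun i => if i.val + 1 = 4 then hh p 2 - kk p 5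
      else if i.val + 1 = 5 then hh p 2 - kk p 4 else p.2 i)
  map_add' p q := by
    ext i
    · fin_cases i <;> simp [hh, kk]; ring
    · simp only [hh, kk, Prod.fst_add, Prod.snd_add, Pi.add_apply]; split_ifs <;> ring
  map_smul' c p := by
    ext i
    · fin_cases i <;> simp [hh, kk]; ring
    · simp only [hh, kk, Prod.smul_fst, Prod.smul_snd, Pi.smul_apply, smul_eq_mul,
        RingHom.id_apply]
      split_ifs <;> ring

/-- `t_j = {k_{j+1} ↔ k_j}` with `j = i + 3`, `1 ≤ i < n`. -/
def linAdd3 (n i : ℕ) (hi : 1 ≤ i) (hin : i < n) : Params n →ₗ[ℂ] Params n where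
  toFun p := (p.1, fun l => if l.val + 1 = i + 3 then kk p (i + 4)
    else if l.val + 1 = i + 4 then kk p (i + 3) else p.2 l)
  map_add' p q := by
    ext l
    · rfl
    · simp only [kk, Prod.snd_add, Pi.add_apply]; split_ifs <;> rfl
  map_smul' c p := by
    ext l
    · rfl
    · simp only [kk, Prod.smul_snd, Pi.smul_apply, RingHom.id_apply]; split_ifs <;> rfl

/-! ### Compatibility -/

/-- The rational function `f` is regular at the point `z` and takes the value `w` there. -/
def HasValueAt {n : ℕ} (f : RatFn n) (z : Vars n → ℂ) (w : ℂ) : Prop :=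
  ∃ P Q : Pol n, MvPolynomial.eval z Q ≠ 0 ∧
    f = algebraMap (Pol n) (RatFn n) P / algebraMap (Pol n) (RatFn n) Q ∧
    w = MvPolynomial.eval z P / MvPolynomial.eval z Q

/-- The value at a regular point is unique. -/
theorem HasValueAt.unique {n : ℕ} {f : RatFn n} {z : Vars n → ℂ} {w w' : ℂ}
    (h : HasValueAt f z w) (h' : HasValueAt f z w') : w = w' := by
  obtain ⟨P, Q, hQ, hf, rfl⟩ := h
  obtain ⟨P', Q', hQ', hf', rfl⟩ := h'
  have inj := IsFractionRing.injective (Pol n) (RatFn n)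
  have n1 : algebraMap (Pol n) (RatFn n) Q ≠ 0 :=
    (map_ne_zero_iff _ inj).2 (by rintro rfl; simp at hQ)
  have n2 : algebraMap (Pol n) (RatFn n) Q' ≠ 0 :=
    (map_ne_zero_iff _ inj).2 (by rintro rfl; simp at hQ')
  rw [hf, div_eq_div_iff n1 n2, ← map_mul, ← map_mul] at hf'
  have := congrArg (MvPolynomial.eval z) (inj hf')
  rw [map_mul, map_mul] at this
  rw [div_eq_div_iff hQ hQ', this]

/-- The rational function `f` is regular at `z`. -/
def RegularAt {n : ℕ} (f : RatFn n) (z : Vars n → ℂ) : Prop := ∃ w, HasValueAt f z w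

/-- Compatibility, under the parametrization, of the action `τ` on the variables `x_i, y_i` with
the action `T` on the parameters: for all parameter values `p` in a dense open set the
parametrization is defined at `p` and at `T p` and the rational functions `τ(x_i)`, `τ(y_i)` are
regular at the point parametrized by `p`; and the value of `τ(x_i)` (or `τ(y_i)`) at the point
parametrized by `p` is the `x_i` (or `y_i`) parametrized by `T p`, whenever both are defined. -/
def Compatible (br : Bracket) {n : ℕ} (τ : RatFn n ≃ₐ[ℂ] RatFn n)
    (T : Params n →ₗ[ℂ] Params n) : Prop :=
  (∃ U : Set (Params n), IsOpen U ∧ Dense U ∧ ∀ p ∈ U, Admissible br p ∧ Admissible br (T p) ∧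
    ∀ v : Vars n, RegularAt (τ (X v)) (param br p)) ∧
  ∀ p : Params n, Admissible br p → Admissible br (T p) → ∀ (v : Vars n) (w : ℂ),
    HasValueAt (τ (X v)) (param br p) w → w = param br (T p) v

end

end TripletPair

/-! The bracket `[u]` enters only through four properties: it is continuous, odd, nonzero on a dense
set, and satisfies the three-term relation `threeTerm = 0`. For `sinh` and the identity the relation
is elementary. For the sigma function it is proved by Liouville: as functions of `a`, the relation
and the product `σ(a+b)σ(a-b)` have the same quasi-periodicity factors, and the former vanishes at
all the zeros of the latter, so their quotient is entire and periodic, hence constant, and it has a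
zero.

Put `pair f h k l = [k-l][h-k-l]`. The three-term relation is a Plücker relation for `pair`, so
`x_i` and `y_i` are cross-ratios of `k₁, k₂, k₃, k_{i+3}` with `h = h₁` and `h = h₂`, and `1 - x_i`,
`1 - y_i` factor as well. Both equations of the system thus become identities between products of
brackets, and they are solved explicitly (`systemFI_crossRatio`): with `l = k_{j+3}` and `m =
k_{i+3}`, the third members are cross-ratios with `h = h₁+h₂-l-m` and arguments `h₁-l` and `h₂-l`.

The new `h` depends on `i`, so a single `σ_j` leaves this form of the parametrization. But the
images satisfy two coincidences. First, `σ_a` at `p` and `σ_b` at `linSigma a b p` give the same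
point (`sigmaParam_linSigma`); as `σ_b` is an involution, `σ_a σ_b` acts by `linSigma a b`. Second,
`σ_1` at `lin₂ p` gives the point of `σ_1` at `p` with the `x` and `y` exchanged
(`sigmaParam_lin₂`), which settles `t_2 = σ_1 ω σ_1`. The other maps are words in `ω` and products
`σ_a σ_b`, so only compositions of linear maps remain.

All this is done for generic `p`, where no relevant bracket vanishes, so that every intermediate map
is regular. Continuity and density then give the value at every admissible `p` where the composite
is regular (`GenericallyMaps.compatible`). -/

open Filter Topology Set

namespace TripletPair

/-! ### The Weierstrass sigma function -/

/-- The elementary factor `(1 - u/l) exp(u/l + u²/(2l²))`; it is `1` for `l = 0`. -/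
noncomputable def sigmaFactor (l u : ℂ) : ℂ :=
  (1 - u / l) * Complex.exp (u / l + u ^ 2 / (2 * l ^ 2))

theorem sigmaFactor_zero_left (u : ℂ) : sigmaFactor 0 u = 1 := by simp [sigmaFactor]

theorem sigmaFactor_zero_right (l : ℂ) : sigmaFactor l 0 = 1 := by simp [sigmaFactor]

theorem sigmaFactor_neg (l u : ℂ) : sigmaFactor (-l) (-u) = sigmaFactor l u := by
  simp [sigmaFactor]

@[fun_prop]
theorem differentiable_sigmaFactor (l : ℂ) : Differentiable ℂ (sigmaFactor l) := by
  unfold sigmaFactor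
  fun_prop

theorem sigmaFactor_ne_zero {l u : ℂ} (h : u ≠ l) : sigmaFactor l u ≠ 0 := by
  refine mul_ne_zero ?_ (Complex.exp_ne_zero _)
  by_cases hl : l = 0
  · simp [hl]
  · rw [sub_ne_zero]
    intro e
    exact h ((eq_div_iff hl).1 e ▸ (one_mul l))

theorem logDeriv_sigmaFactor {l u : ℂ} (hl : l ≠ 0) (h : u ≠ l) :
    logDeriv (sigmaFactor l) u = 1 / (u - l) + 1 / l + u / l ^ 2 := by
  have h1 : HasDerivAt (sigmaFactor l)
      ((-(1 / l)) * Complex.exp (u / l + u ^ 2 / (2 * l ^ 2)) +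
        (1 - u / l) * (Complex.exp (u / l + u ^ 2 / (2 * l ^ 2)) *
          (1 / l + (2 * u) / (2 * l ^ 2)))) u := by
    have ha : HasDerivAt (fun u : ℂ => 1 - u / l) (-(1 / l)) u :=
      ((hasDerivAt_id u).div_const l).const_sub 1
    have hb : HasDerivAt (fun u : ℂ => u / l + u ^ 2 / (2 * l ^ 2))
        (1 / l + (2 * u) / (2 * l ^ 2)) u := by
      have := ((hasDerivAt_id u).div_const l).add (((hasDerivAt_id u).pow 2).div_const (2 * l ^ 2))
      simpa using! this
    exact ha.mul hb.cexp
  rw [logDeriv_apply, h1.deriv, sigmaFactor]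
  have h2 : u - l ≠ 0 := sub_ne_zero.2 h
  have h3 : (1 - u / l) ≠ 0 := by
    rw [sub_ne_zero]; intro e; exact h ((eq_div_iff hl).1 e ▸ (one_mul l))
  have h4 := Complex.exp_ne_zero (u / l + u ^ 2 / (2 * l ^ 2))
  generalize Complex.exp (u / l + u ^ 2 / (2 * l ^ 2)) = e at *
  have h5 : l - u ≠ 0 := sub_ne_zero.2 h.symm
  have h6 : 1 - u / l = (l - u) / l := by field_simp
  rw [h6, show u - l = -(l - u) by ring]
  field_simp
  ring

/-- The derivative is `-t² exp(t + t²/2)`, so the mean value inequality on the disc of radius `‖t‖`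
gives a cubic bound. Cubic decay is what makes the product over a lattice of rank two converge. -/
theorem norm_one_sub_mul_exp_sub_one_le {t : ℂ} (ht : ‖t‖ ≤ 1) :
    ‖(1 - t) * Complex.exp (t + t ^ 2 / 2) - 1‖ ≤ Real.exp 2 * ‖t‖ ^ 3 := by
  have hd : ∀ x : ℂ, HasDerivAt (fun t : ℂ => (1 - t) * Complex.exp (t + t ^ 2 / 2))
      (-x ^ 2 * Complex.exp (x + x ^ 2 / 2)) x := by
    intro x
    have ha : HasDerivAt (fun u : ℂ => 1 - u) (-1) x := (hasDerivAt_id x).const_sub 1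
    have hb : HasDerivAt (fun u : ℂ => u + u ^ 2 / 2) (1 + x) x := by
      have := (hasDerivAt_id x).add (((hasDerivAt_id x).pow 2).div_const 2)
      simpa using! this
    have := ha.mul hb.cexp
    exact this.congr_deriv (by ring)
  have hb : ∀ x ∈ Metric.closedBall (0 : ℂ) ‖t‖,
      ‖-x ^ 2 * Complex.exp (x + x ^ 2 / 2)‖ ≤ Real.exp 2 * ‖t‖ ^ 2 := by
    intro x hx
    have hx : ‖x‖ ≤ ‖t‖ := by simpa using hx
    rw [norm_mul, norm_neg, norm_pow, mul_comm]
    gcongr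
    rw [Complex.norm_exp, Real.exp_le_exp]
    refine (Complex.re_le_norm _).trans ((norm_add_le _ _).trans ?_)
    rw [norm_div, norm_pow, Complex.norm_ofNat]
    nlinarith [norm_nonneg x]
  have := (convex_closedBall (0 : ℂ) ‖t‖).norm_image_sub_le_of_norm_hasDerivWithin_le
    (fun x _ => (hd x).hasDerivWithinAt) hb (x := 0) (y := t) (by simp) (by simp)
  simpa [pow_succ, mul_assoc] using this

theorem norm_sigmaFactor_sub_one_le {r : ℝ} {l u : ℂ} (hu : ‖u‖ ≤ r) (hl : r ≤ ‖l‖) :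
    ‖sigmaFactor l u - 1‖ ≤ Real.exp 2 * r ^ 3 * ‖l‖ ^ (-3 : ℝ) := by
  by_cases h0 : l = 0
  · rw [h0, sigmaFactor_zero_left]
    have : 0 ≤ r := (norm_nonneg _).trans hu
    simp
  have hl0 : 0 < ‖l‖ := norm_pos_iff.2 h0
  have ht : ‖u / l‖ ≤ 1 := by
    rw [norm_div]
    exact div_le_one_of_le₀ (hu.trans hl) hl0.le
  have h := norm_one_sub_mul_exp_sub_one_le ht
  have e : u / l + u ^ 2 / (2 * l ^ 2) = u / l + (u / l) ^ 2 / 2 := by field_simp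
  rw [sigmaFactor, e]
  refine h.trans ?_
  have e3 : ‖l‖ ^ (-3 : ℝ) = (‖l‖ ^ 3)⁻¹ := by norm_cast
  rw [e3, norm_div, div_pow, mul_assoc, div_eq_mul_inv]
  gcongr

/-! ### The sigma product of a lattice: convergence, oddness, non-vanishing off the lattice. -/

section Weierstrass

variable (L : PeriodPair)

theorem finite_lattice_norm_lt (r : ℝ) : {l : L.lattice | ‖(l : ℂ)‖ < r}.Finite := by
  refine (isCompact_iff_finite.mp (isCompact_closedBall (0 : L.lattice) r)).subset ?_
  intro l hl
  simpa using le_of_lt hl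

theorem summable_lattice_norm_rpow : Summable fun l : L.lattice => ‖(l : ℂ)‖ ^ (-3 : ℝ) :=
  ZLattice.summable_norm_rpow L.lattice _ (by simp; norm_num)

theorem multipliableLocallyUniformlyOn_sigmaFactor (r : ℝ) :
    MultipliableLocallyUniformlyOn (fun (l : L.lattice) u => sigmaFactor l u)
      (Metric.ball 0 r) := by
  have := Summable.multipliableLocallyUniformlyOn_one_add
    (f := fun (l : L.lattice) u => sigmaFactor l u - 1) (K := Metric.ball (0 : ℂ) r)
    Metric.isOpen_ball
    ((summable_lattice_norm_rpow L).mul_left (Real.exp 2 * r ^ 3)) ?_ ?_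
  · simpa using this
  · refine (finite_lattice_norm_lt L r).subset fun l hl => ?_
    by_contra h
    refine hl fun u hu => ?_
    simp only [mem_ofPred_eq, not_lt] at h
    exact norm_sigmaFactor_sub_one_le (by simpa using (Metric.mem_ball.1 hu).le) h
  · intro l
    exact ((differentiable_sigmaFactor _).sub_const 1).continuous.continuousOn

/-- The product of the elementary factors of the sigma function. -/
noncomputable def sigmaProd (u : ℂ) : ℂ := ∏' l : L.lattice, sigmaFactor l u

/-- Since division by zero makes the factor at `l = 0` equal to `1`, the product may run over the
whole lattice, on which negation and summability are available. -/
theorem weierstrassSigma_eq (u : ℂ) : weierstrassSigma L u = u * sigmaProd L u := by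
  rw [weierstrassSigma, sigmaProd]
  congr 1
  have hg : Function.Injective
      (fun w : {w : ℂ // w ∈ L.lattice ∧ w ≠ 0} => (⟨w, w.2.1⟩ : L.lattice)) := by
    intro a b h
    simpa [Subtype.ext_iff] using h
  refine (hg.tprod_eq (f := fun l : L.lattice => sigmaFactor l u) ?_)
  intro l hl
  refine ⟨⟨l, l.2, ?_⟩, rfl⟩
  intro h
  exact hl (by simp [h, sigmaFactor_zero_left])

@[fun_prop]
theorem differentiable_sigmaProd : Differentiable ℂ (sigmaProd L) := by
  intro u
  have h := (multipliableLocallyUniformlyOn_sigmaFactor L (‖u‖ + 1)).hasProdLocallyUniformlyOn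
  refine DifferentiableOn.differentiableAt (s := Metric.ball 0 (‖u‖ + 1)) ?_
    (Metric.isOpen_ball.mem_nhds (by simp))
  refine TendstoLocallyUniformlyOn.differentiableOn h (.of_forall fun s => ?_) Metric.isOpen_ball
  exact (Differentiable.fun_finsetProd (u := s) (f := fun (l : L.lattice) u => sigmaFactor l u)
    fun i _ => differentiable_sigmaFactor (i : ℂ)).differentiableOn

theorem differentiable_weierstrassSigma : Differentiable ℂ (weierstrassSigma L) := by
  rw [funext (weierstrassSigma_eq L)]
  fun_prop

theorem sigmaProd_zero : sigmaProd L 0 = 1 := by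
  simp [sigmaProd, sigmaFactor_zero_right]

theorem sigmaProd_neg (u : ℂ) : sigmaProd L (-u) = sigmaProd L u := by
  rw [sigmaProd, sigmaProd, ← (Equiv.neg L.lattice).tprod_eq]
  simp [sigmaFactor_neg]

theorem weierstrassSigma_neg (u : ℂ) : weierstrassSigma L (-u) = -weierstrassSigma L u := by
  rw [weierstrassSigma_eq, weierstrassSigma_eq, sigmaProd_neg, neg_mul]

theorem sigmaProd_ne_zero {u : ℂ} (hu : u ∉ L.lattice) : sigmaProd L u ≠ 0 := by
  have := tprod_one_add_ne_zero_of_summable (f := fun l : L.lattice => sigmaFactor l u - 1) ?_ ?_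
  · simpa [sigmaProd] using this
  · intro l
    simpa using sigmaFactor_ne_zero fun h => hu (by rw [h]; exact l.2)
  · refine Summable.of_norm_bounded_eventually
      ((summable_lattice_norm_rpow L).mul_left (Real.exp 2 * ‖u‖ ^ 3)) ?_
    refine (finite_lattice_norm_lt L ‖u‖).subset fun l hl => ?_
    by_contra h
    simp only [mem_ofPred_eq, not_lt] at h
    refine hl ?_
    simpa using norm_sigmaFactor_sub_one_le le_rfl h

theorem weierstrassSigma_ne_zero {u : ℂ} (hu : u ∉ L.lattice) : weierstrassSigma L u ≠ 0 := by
  rw [weierstrassSigma_eq]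
  exact mul_ne_zero (fun h => hu (h ▸ zero_mem _)) (sigmaProd_ne_zero L hu)

theorem deriv_weierstrassSigma_zero : deriv (weierstrassSigma L) 0 = 1 := by
  rw [funext (weierstrassSigma_eq L)]
  have := (hasDerivAt_id (0 : ℂ)).mul (differentiable_sigmaProd L 0).hasDerivAt
  simpa [sigmaProd_zero] using! this.deriv

/-! ### The zeta function as logarithmic derivative of the sigma function. -/

/-- The terms of the Weierstrass zeta function without its pole at `0`. -/
noncomputable def zetaTerm (l : L.lattice) (u : ℂ) : ℂ :=
  if (l : ℂ) = 0 then 0 else 1 / (u - l) + 1 / l + u / (l : ℂ) ^ 2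

/-- The Weierstrass zeta function without its pole at `0`. -/
noncomputable def zetaExcept (u : ℂ) : ℂ := ∑' l : L.lattice, zetaTerm L l u

/-- For `l ≠ 0` the three fractions combine to `u² / ((u - l) l²)`, and `‖u - l‖ ≥ ‖l‖ / 2` in this
range. -/
theorem norm_zetaTerm_le {r : ℝ} (hr : 0 < r) {u : ℂ} (hu : ‖u‖ < r) {l : L.lattice}
    (h : 2 * r ≤ ‖(l : ℂ)‖) : ‖zetaTerm L l u‖ ≤ 2 * r ^ 2 * ‖(l : ℂ)‖ ^ (-3 : ℝ) := by
  have hl : 0 < ‖(l : ℂ)‖ := by linarith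
  have hl0 : (l : ℂ) ≠ 0 := norm_pos_iff.1 hl
  have hul : ‖(l : ℂ)‖ / 2 ≤ ‖u - l‖ := by
    rw [norm_sub_rev]
    exact le_trans (by linarith) (norm_sub_norm_le _ _)
  have hul0 : u - l ≠ 0 := norm_pos_iff.1 (by linarith)
  have e : zetaTerm L l u = u ^ 2 / ((u - l) * (l : ℂ) ^ 2) := by
    rw [zetaTerm, if_neg hl0]
    field_simp
    ring
  have e3 : ‖(l : ℂ)‖ ^ (-3 : ℝ) = (‖(l : ℂ)‖ ^ 3)⁻¹ := by norm_cast
  rw [e, e3, norm_div, norm_mul, norm_pow, norm_pow]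
  calc ‖u‖ ^ 2 / (‖u - l‖ * ‖(l : ℂ)‖ ^ 2) ≤ r ^ 2 / (‖(l : ℂ)‖ / 2 * ‖(l : ℂ)‖ ^ 2) := by gcongr
    _ = _ := by field_simp

theorem hasSumLocallyUniformly_zetaExcept :
    HasSumLocallyUniformly (zetaTerm L) (zetaExcept L) := by
  refine L.hasSumLocallyUniformly_aux _ (u := fun r l => 2 * r ^ 2 * ‖(l : ℂ)‖ ^ (-3 : ℝ))
    (fun _ _ => (summable_lattice_norm_rpow L).mul_left _) fun r hr =>
    Filter.eventually_atTop.mpr ⟨2 * r, ?_⟩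
  rintro _ h s hs l rfl
  exact norm_zetaTerm_le L hr hs h

theorem hasDerivAt_zetaTerm (l : L.lattice) {u : ℂ} (hu : u ∉ (L.lattice : Set ℂ)) :
    HasDerivAt (zetaTerm L l) (-(if (l : ℂ) = 0 then 0 else (1 / (u - l) ^ 2 - 1 / (l : ℂ) ^ 2)))
      u := by
  unfold zetaTerm
  split_ifs with h
  · simpa using hasDerivAt_const u (0 : ℂ)
  · have hul : u - l ≠ 0 := sub_ne_zero.2 fun e => hu (e ▸ l.2)
    have := ((((hasDerivAt_id u).sub_const (l : ℂ)).inv hul).add_const (1 / (l : ℂ))).add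
      ((hasDerivAt_id u).div_const ((l : ℂ) ^ 2))
    simp only [id] at this
    refine (this.congr_deriv (by ring)).congr_of_eventuallyEq (.of_forall fun v => ?_)
    simp

theorem differentiableOn_zetaExcept : DifferentiableOn ℂ (zetaExcept L) (L.lattice : Set ℂ)ᶜ :=
  (hasSumLocallyUniformly_zetaExcept L).hasSumLocallyUniformlyOn.differentiableOn
    (.of_forall fun _ => .fun_sum fun i _ _ hu =>
      (hasDerivAt_zetaTerm L i hu).differentiableAt.differentiableWithinAt)
    L.isClosed_lattice.isOpen_compl

/-- Locally uniform convergence of holomorphic functions permits termwise differentiation; the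
derivatives are the terms of the `℘` series other than the one at `0`. -/
theorem deriv_zetaExcept {u : ℂ} (hu : u ∉ (L.lattice : Set ℂ)) :
    deriv (zetaExcept L) u = -L.weierstrassPExcept 0 u := by
  have h1 := (hasSumLocallyUniformly_zetaExcept L).hasSumLocallyUniformlyOn (s := (L.lattice : Set ℂ)ᶜ)
  have h2 := TendstoLocallyUniformlyOn.deriv h1
    (.of_forall fun _ => .fun_sum fun i _ _ hu =>
      (hasDerivAt_zetaTerm L i hu).differentiableAt.differentiableWithinAt)
    L.isClosed_lattice.isOpen_compl
  refine tendsto_nhds_unique (h2.tendsto_at hu) ?_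
  refine (L.hasSum_weierstrassPExcept 0 u).neg.congr fun s => ?_
  exact (HasDerivAt.fun_sum fun i _ => hasDerivAt_zetaTerm L i hu).deriv.symm

theorem logDeriv_weierstrassSigma {u : ℂ} (hu : u ∉ (L.lattice : Set ℂ)) :
    logDeriv (weierstrassSigma L) u = 1 / u + zetaExcept L u := by
  have hu0 : u ≠ 0 := fun h => hu (h ▸ zero_mem _)
  have hne : ∀ l : L.lattice, u ≠ l := fun l h => hu (h ▸ l.2)
  have e : ∀ l : L.lattice, logDeriv (sigmaFactor l) u = zetaTerm L l u := by
    intro l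
    unfold zetaTerm
    split_ifs with h
    · rw [h, show sigmaFactor 0 = fun _ => 1 from funext sigmaFactor_zero_left]
      simp
    · exact logDeriv_sigmaFactor h (hne l)
  rw [funext (weierstrassSigma_eq L), logDeriv_mul (f := fun u => u) u hu0 (sigmaProd_ne_zero L hu)
    differentiableAt_id (differentiable_sigmaProd L u), logDeriv_id']
  congr 1
  have := logDeriv_tprod_eq_tsum (f := fun (l : L.lattice) u => sigmaFactor l u)
    Metric.isOpen_ball (x := u) (s := Metric.ball 0 (‖u‖ + 1)) (by simp)
    (fun l => sigmaFactor_ne_zero (hne l)) (fun l => (differentiable_sigmaFactor _).differentiableOn)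
    ?_ (multipliableLocallyUniformlyOn_sigmaFactor L _) (sigmaProd_ne_zero L hu)
  · exact this.trans (tsum_congr e)
  · exact ((hasSumLocallyUniformly_zetaExcept L).hasSum (x := u)).summable.congr fun l => (e l).symm

/-! ### Quasi-periodicity of the sigma function and its simple zeros. -/

theorem countable_lattice : (L.lattice : Set ℂ).Countable :=
  countable_of_Lindelof_of_discrete (X := L.lattice)

theorem add_notMem_lattice (l : L.lattice) {u : ℂ} (hu : u ∈ (L.lattice : Set ℂ)ᶜ) :
    u + l ∈ (L.lattice : Set ℂ)ᶜ :=
  fun h => hu (by simpa using sub_mem (S := Submodule ℤ ℂ) h l.2)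

theorem isPreconnected_compl_lattice : IsPreconnected (L.lattice : Set ℂ)ᶜ :=
  ((countable_lattice L).isConnected_compl_of_one_lt_rank (by simp)).2

/-- The logarithmic derivative of the sigma function is quasi-periodic. -/
theorem exists_logDeriv_weierstrassSigma_add (l : L.lattice) :
    ∃ η : ℂ, ∀ u ∈ (L.lattice : Set ℂ)ᶜ,
      logDeriv (weierstrassSigma L) (u + l) = logDeriv (weierstrassSigma L) u + η := by
  let Z : ℂ → ℂ := fun u => 1 / u + zetaExcept L u
  have hZ : ∀ u ∈ (L.lattice : Set ℂ)ᶜ, HasDerivAt Z (-L.weierstrassP u) u := by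
    intro u hu
    have hu0 : u ≠ 0 := fun h => hu (h ▸ zero_mem _)
    have h := (hasDerivAt_inv hu0).add ((differentiableOn_zetaExcept L).differentiableAt
      (L.isClosed_lattice.isOpen_compl.mem_nhds hu)).hasDerivAt
    rw [deriv_zetaExcept L hu] at h
    have e := L.weierstrassPExcept_add 0 u
    simp only [ZeroMemClass.coe_zero, sub_zero] at e
    refine (h.congr_deriv ?_).congr_of_eventuallyEq (.of_forall fun v => by simp [Z])
    rw [← e]
    simp
  -- `Z' = -℘` is periodic, so `Z(u + l) - Z(u)` has derivative zero on the connected complement of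
  -- the lattice.
  have hd : ∀ u ∈ (L.lattice : Set ℂ)ᶜ, HasDerivAt (fun u => Z (u + l) - Z u) 0 u := by
    intro u hu
    have h1 := (hZ _ (add_notMem_lattice L l hu)).comp_add_const u (l : ℂ)
    exact (h1.sub (hZ u hu)).congr_deriv (by simp)
  obtain ⟨η, hη⟩ := L.isClosed_lattice.isOpen_compl.exists_is_const_of_deriv_eq_zero
    (isPreconnected_compl_lattice L)
    (fun u hu => (hd u hu).differentiableAt.differentiableWithinAt)
    (fun u hu => (hd u hu).deriv)
  refine ⟨η, fun u hu => ?_⟩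
  rw [logDeriv_weierstrassSigma L hu, logDeriv_weierstrassSigma L (add_notMem_lattice L l hu)]
  have := hη u hu
  simp only [Z] at this
  linear_combination this

/-- The sigma function is quasi-periodic. -/
theorem exists_weierstrassSigma_add (l : L.lattice) :
    ∃ C η : ℂ, C ≠ 0 ∧
      ∀ u, weierstrassSigma L (u + l) = C * (Complex.exp (η * u) * weierstrassSigma L u) := by
  obtain ⟨η, hη⟩ := exists_logDeriv_weierstrassSigma_add L l
  have hs := differentiable_weierstrassSigma L
  have hne : ∀ u ∈ (L.lattice : Set ℂ)ᶜ, weierstrassSigma L u ≠ 0 :=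
    fun u hu => weierstrassSigma_ne_zero L hu
  have d1 : Differentiable ℂ fun u => weierstrassSigma L (u + l) := by fun_prop
  have d2 : Differentiable ℂ fun u => Complex.exp (η * u) := by fun_prop
  have d3 : Differentiable ℂ fun u => Complex.exp (η * u) * weierstrassSigma L u := by fun_prop
  -- Equal logarithmic derivatives off the lattice make the two functions proportional there;
  -- continuity and density of the complement then cover the lattice points.
  obtain ⟨C, hC, h⟩ := (logDeriv_eqOn_iff (f := fun u => weierstrassSigma L (u + l))
    (g := fun u => Complex.exp (η * u) * weierstrassSigma L u) d1.differentiableOn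
    d3.differentiableOn L.isClosed_lattice.isOpen_compl (isPreconnected_compl_lattice L)
    (fun u hu => mul_ne_zero (Complex.exp_ne_zero _) (hne u hu))
    (fun u hu => hne _ (add_notMem_lattice L l hu))).1 (by
      intro u hu
      have e1 : logDeriv (fun u => weierstrassSigma L (u + l)) u =
          logDeriv (weierstrassSigma L) (u + l) := by
        simp only [logDeriv_apply, deriv_comp_add_const]
      have e2 : logDeriv (fun u => Complex.exp (η * u)) u = η := by
        have : HasDerivAt (fun u => Complex.exp (η * u)) (Complex.exp (η * u) * η) u := by
          simpa using ((hasDerivAt_id u).const_mul η).cexp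
        rw [logDeriv_apply, this.deriv, mul_div_cancel_left₀ _ (Complex.exp_ne_zero _)]
      rw [e1, hη u hu, logDeriv_mul (f := fun u => Complex.exp (η * u)) u
          (Complex.exp_ne_zero _) (hne u hu) (d2 u) (hs u), e2,
        add_comm])
  refine ⟨C, η, hC, fun u => ?_⟩
  have := d1.continuous.ext_on ((countable_lattice L).dense_compl ℂ)
    (d3.continuous.const_smul C) h
  simpa using congrFun this u

/-- Quasi-periodicity carries the zero at the origin to every lattice point. -/
theorem weierstrassSigma_of_mem {u : ℂ} (hu : u ∈ L.lattice) : weierstrassSigma L u = 0 := by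
  obtain ⟨C, η, -, h⟩ := exists_weierstrassSigma_add L ⟨u, hu⟩
  have h0 : weierstrassSigma L 0 = 0 := by rw [weierstrassSigma_eq, zero_mul]
  simpa [h0] using h 0

theorem weierstrassSigma_eq_zero_iff {u : ℂ} : weierstrassSigma L u = 0 ↔ u ∈ L.lattice :=
  ⟨fun h => by_contra fun hu => weierstrassSigma_ne_zero L hu h, weierstrassSigma_of_mem L⟩

/-- The zeros of the sigma function are simple. -/
theorem deriv_weierstrassSigma_ne_zero {u : ℂ} (hu : u ∈ L.lattice) :
    deriv (weierstrassSigma L) u ≠ 0 := by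
  obtain ⟨C, η, hC, h⟩ := exists_weierstrassSigma_add L ⟨u, hu⟩
  have h0 : weierstrassSigma L 0 = 0 := weierstrassSigma_of_mem L (zero_mem _)
  have h1 : HasDerivAt (fun v => Complex.exp (η * v)) (Complex.exp (η * 0) * η) 0 := by
    simpa using ((hasDerivAt_id (0 : ℂ)).const_mul η).cexp
  have h2 := ((h1.mul (differentiable_weierstrassSigma L 0).hasDerivAt).const_mul C).deriv
  have h3 : deriv (fun v => weierstrassSigma L (v + u)) 0 = deriv (weierstrassSigma L) u := by
    rw [deriv_comp_add_const, zero_add]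
  rw [← h3, funext h]
  have : deriv (fun v => C * (Complex.exp (η * v) * weierstrassSigma L v)) 0 = C := by
    refine h2.trans ?_
    simp [h0, deriv_weierstrassSigma_zero]
  rwa [this]

/-! ### The three-term relation by Liouville's theorem. -/

/-- An entire function that vanishes at all zeros of an entire function with simple zeros is
divisible by it. -/
theorem exists_entire_mul_of_simple_zeros {f g : ℂ → ℂ} (hf : Differentiable ℂ f)
    (hg : Differentiable ℂ g) (hs : ∀ a, g a = 0 → deriv g a ≠ 0) (h : ∀ a, g a = 0 → f a = 0) :
    ∃ q : ℂ → ℂ, Differentiable ℂ q ∧ ∀ a, f a = q a * g a := by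
  -- At a zero of `g` the quotient takes its l'Hôpital value; near such a point it coincides with
  -- the quotient of the two `dslope`s, which is differentiable.
  refine ⟨fun a => if g a = 0 then deriv f a / deriv g a else f a / g a, fun a => ?_, fun a => ?_⟩
  · by_cases ha : g a = 0
    · have df : DifferentiableAt ℂ (dslope f a) a :=
        ((Complex.differentiableOn_dslope univ_mem).2 hf.differentiableOn).differentiableAt univ_mem
      have dg : DifferentiableAt ℂ (dslope g a) a :=
        ((Complex.differentiableOn_dslope univ_mem).2 hg.differentiableOn).differentiableAt univ_mem
      have hne : dslope g a a ≠ 0 := by rw [dslope_same]; exact hs a ha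
      refine (df.div dg hne).congr_of_eventuallyEq ?_
      filter_upwards [dg.continuousAt.eventually_ne hne] with z hz
      by_cases hza : z = a
      · simp [hza, ha]
      · have hza' : z - a ≠ 0 := sub_ne_zero.2 hza
        have e1 : dslope f a z = f z / (z - a) := by
          rw [dslope_of_ne _ hza, slope_def_field, h a ha, sub_zero]
        have e2 : dslope g a z = g z / (z - a) := by
          rw [dslope_of_ne _ hza, slope_def_field, ha, sub_zero]
        have hgz : g z ≠ 0 := by
          intro h0; apply hz; rw [e2, h0, zero_div]
        simp only [if_neg hgz, Pi.div_apply]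
        rw [e1, e2]
        field_simp
    · refine ((hf a).div (hg a) ha).congr_of_eventuallyEq ?_
      filter_upwards [(hg a).continuousAt.eventually_ne ha] with z hz
      simp [hz]
  · beta_reduce
    split_ifs with ha
    · rw [h a ha, ha, mul_zero]
    · rw [div_mul_cancel₀ _ ha]

/-- The three-term expression of the sigma function, in terms of a general function. -/
def threeTerm (f : ℂ → ℂ) (a b c d : ℂ) : ℂ :=
  f (a + b) * f (a - b) * (f (c + d) * f (c - d)) +
    f (a + c) * f (a - c) * (f (d + b) * f (d - b)) +
    f (a + d) * f (a - d) * (f (b + c) * f (b - c))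

/-- The exponents `η(a+b)` and `η(a-b)` add up to `2ηa`, so the multiplier is independent of `b`.
Hence all three terms of `threeTerm`, as functions of `a`, are multiplied by the same factor. -/
theorem exists_weierstrassSigma_pair_add (l : L.lattice) :
    ∃ m : ℂ → ℂ, (∀ a, m a ≠ 0) ∧ ∀ a b, weierstrassSigma L (a + l + b) *
      weierstrassSigma L (a + l - b) =
        m a * (weierstrassSigma L (a + b) * weierstrassSigma L (a - b)) := by
  obtain ⟨C, η, hC, h⟩ := exists_weierstrassSigma_add L l
  refine ⟨fun a => C ^ 2 * Complex.exp (2 * (η * a)),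
    fun a => mul_ne_zero (pow_ne_zero 2 hC) (Complex.exp_ne_zero _), fun a b => ?_⟩
  beta_reduce
  rw [show a + l + b = a + b + l by ring, show a + l - b = a - b + l by ring, h, h,
    show 2 * (η * a) = η * (a + b) + η * (a - b) by ring, Complex.exp_add]
  ring

/-- Divide by `g(a) = σ(a+b)σ(a-b)`. Oddness gives zeros of the expression at `a = ±b`, hence at all
zeros of `g`. These are simple because `2b` is not a period. The conditions on `c ± b` give `g(c) ≠
0`, so the constant quotient can be evaluated at `a = c`, where the expression vanishes. -/
theorem threeTerm_weierstrassSigma_of_generic {b c : ℂ} (d : ℂ) (hb : 2 * b ∉ L.lattice)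
    (hbc : c + b ∉ L.lattice) (hbc' : c - b ∉ L.lattice) (a : ℂ) :
    threeTerm (weierstrassSigma L) a b c d = 0 := by
  have hσ := differentiable_weierstrassSigma L
  have odd := weierstrassSigma_neg L
  have hz := fun u => weierstrassSigma_eq_zero_iff L (u := u)
  let g : ℂ → ℂ := fun a => weierstrassSigma L (a + b) * weierstrassSigma L (a - b)
  let E : ℂ → ℂ := fun a => threeTerm (weierstrassSigma L) a b c d
  have hg : Differentiable ℂ g := by fun_prop
  have hE : Differentiable ℂ E := by unfold E threeTerm; fun_prop
  have hper : ∀ l : L.lattice, ∃ m : ℂ → ℂ, (∀ a, m a ≠ 0) ∧ (∀ a, g (a + l) = m a * g a) ∧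
      ∀ a, E (a + l) = m a * E a := by
    intro l
    obtain ⟨m, hm, h⟩ := exists_weierstrassSigma_pair_add L l
    refine ⟨m, hm, fun a => h a b, fun a => ?_⟩
    simp only [E, threeTerm, h]
    ring
  have σ0 : weierstrassSigma L 0 = 0 := weierstrassSigma_of_mem L (zero_mem _)
  have hEb : E b = 0 := by
    simp only [E, threeTerm, sub_self, σ0]
    rw [← neg_sub b d, odd, add_comm d b]
    ring
  have hEb' : E (-b) = 0 := by
    simp only [E, threeTerm, neg_add_cancel, σ0]
    rw [show -b + c = -(b - c) by ring, show -b - c = -(b + c) by ring,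
      show -b + d = d - b by ring, show -b - d = -(d + b) by ring]
    simp only [odd]
    ring
  have hEg : ∀ a, g a = 0 → E a = 0 := by
    intro a ha
    rcases mul_eq_zero.1 ha with ha | ha
    · obtain ⟨m, -, -, h⟩ := hper ⟨_, (hz _).1 ha⟩
      have := h (-b)
      rwa [hEb', mul_zero, show -b + (a + b) = a by ring] at this
    · obtain ⟨m, -, -, h⟩ := hper ⟨_, (hz _).1 ha⟩
      have := h b
      rwa [hEb, mul_zero, show b + (a - b) = a by ring] at this
  have hgs : ∀ a, g a = 0 → deriv g a ≠ 0 := by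
    intro a ha
    have d1 : HasDerivAt (fun a => weierstrassSigma L (a + b)) _ a :=
      (hσ (a + b)).hasDerivAt.comp_add_const a b
    have d2 : HasDerivAt (fun a => weierstrassSigma L (a - b)) _ a :=
      (hσ (a - b)).hasDerivAt.comp_sub_const a b
    rw [show deriv g a = _ from (d1.mul d2).deriv]
    have key : ¬ (a + b ∈ L.lattice ∧ a - b ∈ L.lattice) := by
      rintro ⟨h1, h2⟩
      apply hb
      have := sub_mem h1 h2
      rwa [show a + b - (a - b) = 2 * b by ring] at this
    rcases mul_eq_zero.1 ha with ha | ha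
    · rw [ha, zero_mul, add_zero]
      exact mul_ne_zero (deriv_weierstrassSigma_ne_zero L ((hz _).1 ha))
        fun h => key ⟨(hz _).1 ha, (hz _).1 h⟩
    · rw [ha, mul_zero, zero_add]
      exact mul_ne_zero (fun h => key ⟨(hz _).1 h, (hz _).1 ha⟩)
        (deriv_weierstrassSigma_ne_zero L ((hz _).1 ha))
  obtain ⟨q, hq, hqE⟩ := exists_entire_mul_of_simple_zeros hE hg hgs hEg
  have hdense : Dense {a | g a ≠ 0} := by
    have h1 : ({a : ℂ | a + b ∈ L.lattice} ∪ {a | a - b ∈ L.lattice}).Countable :=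
      ((countable_lattice L).preimage (add_left_injective b)).union
        ((countable_lattice L).preimage (sub_left_injective (b := b)))
    refine (h1.dense_compl ℂ).mono fun a ha => ?_
    simp only [mem_compl_iff, mem_union, mem_ofPred_eq, not_or] at ha
    exact mul_ne_zero (fun h => ha.1 ((hz _).1 h)) fun h => ha.2 ((hz _).1 h)
  -- The common multiplier cancels wherever `g ≠ 0`, and by continuity the periodicity of `q`
  -- extends from this dense set.
  have hqper : ∀ z w : ℂ, w ∈ L.lattice → q (z + w) = q z := by
    intro z w hw
    obtain ⟨m, hm, h1, h2⟩ := hper ⟨w, hw⟩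
    have hqc : Continuous fun z => q (z + w) := hq.continuous.comp (by fun_prop)
    refine congrFun (hqc.ext_on hdense hq.continuous fun a ha => ?_) z
    have e := h2 a
    rw [hqE, hqE, h1] at e
    exact mul_right_cancel₀ (mul_ne_zero (hm a) ha) (by linear_combination e)
  have hconst := fun x y => hq.apply_eq_apply_of_bounded
    (IsZLattice.isCompact_range_of_periodic L.lattice q hq.continuous hqper).isBounded x y
  have hEc : E c = 0 := by
    simp only [E, threeTerm, sub_self, σ0]
    rw [← neg_sub c b, odd, add_comm b c]
    ring
  have hqc : q c = 0 := by
    have := hqE c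
    rw [hEc] at this
    exact (mul_eq_zero.1 this.symm).resolve_right
      (mul_ne_zero (weierstrassSigma_ne_zero L hbc) (weierstrassSigma_ne_zero L hbc'))
  change E a = 0
  rw [hqE, hconst a c, hqc, zero_mul]

/-- The values of `b` excluded in the generic case form a countable set, and the expression is
continuous in `b`. -/
theorem threeTerm_weierstrassSigma (a b c d : ℂ) : threeTerm (weierstrassSigma L) a b c d = 0 := by
  have hσ := (differentiable_weierstrassSigma L).continuous
  have hE : Continuous fun b => threeTerm (weierstrassSigma L) a b c d := by
    unfold threeTerm
    fun_prop
  have h1 : ({b : ℂ | 2 * b ∈ L.lattice} ∪ {b | c + b ∈ L.lattice} ∪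
      {b | c - b ∈ L.lattice}).Countable :=
    (((countable_lattice L).preimage (mul_right_injective₀ two_ne_zero)).union
      ((countable_lattice L).preimage (add_right_injective c))).union
      ((countable_lattice L).preimage (sub_right_injective (b := c)))
  refine congrFun (hE.ext_on (h1.dense_compl ℂ) continuous_const fun b hb => ?_) b
  simp only [mem_compl_iff, mem_union, mem_ofPred_eq, not_or] at hb
  exact threeTerm_weierstrassSigma_of_generic L d hb.1.1 hb.1.2 hb.2 a

end Weierstrass

/-! ### The bracket function -/

namespace Bracket
variable (br : Bracket)

theorem continuous_fn : Continuous br.fn := by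
  cases br with
  | elliptic L => exact (differentiable_weierstrassSigma L).continuous
  | trigonometric => exact Complex.continuous_sinh
  | rational => exact continuous_id

theorem fn_neg (u : ℂ) : br.fn (-u) = -br.fn u := by
  cases br with
  | elliptic L => exact weierstrassSigma_neg L u
  | trigonometric => exact Complex.sinh_neg u
  | rational => rfl

/-- In the two degenerate cases `[a+b][a-b]` is a difference `φ(a) - φ(b)`, with `φ = cosh²` or
`φ(u) = u²`, and the relation is a polynomial identity in the values of `φ`. -/
theorem threeTerm_fn (a b c d : ℂ) : threeTerm br.fn a b c d = 0 := by
  cases br with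
  | elliptic L => exact threeTerm_weierstrassSigma L a b c d
  | trigonometric =>
    have h : ∀ a b : ℂ, Complex.sinh (a + b) * Complex.sinh (a - b) =
        Complex.cosh a ^ 2 - Complex.cosh b ^ 2 := by
      intro a b
      rw [Complex.sinh_add, Complex.sinh_sub]
      linear_combination (Complex.cosh b ^ 2) * (Complex.cosh_sq a).symm -
        (Complex.cosh a ^ 2) * (Complex.cosh_sq b).symm
    simp only [threeTerm, fn, h]
    ring
  | rational =>
    simp only [threeTerm, fn]
    ring

theorem dense_fn_ne_zero : Dense {u | br.fn u ≠ 0} := by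
  cases br with
  | elliptic L =>
    refine ((countable_lattice L).dense_compl ℂ).mono fun u hu => ?_
    exact weierstrassSigma_ne_zero L hu
  | trigonometric =>
    have h : {u : ℂ | Complex.sinh u = 0}.Countable := by
      have : {u : ℂ | Complex.sinh u = 0} ⊆ range fun n : ℤ => -(n * Real.pi * Complex.I) := by
        intro u hu
        have h1 : Complex.sin (u * Complex.I) = 0 := by
          rw [Complex.sin_mul_I]
          simp only [mem_ofPred_eq] at hu
          rw [hu, zero_mul]
        obtain ⟨n, hn⟩ := Complex.sin_eq_zero_iff.1 h1
        refine ⟨n, ?_⟩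
        simp only
        rw [← hn, mul_assoc, Complex.I_mul_I]
        ring
      exact (countable_range _).mono this
    exact h.dense_compl ℂ
  | rational => exact (countable_singleton (0 : ℂ)).dense_compl ℂ

end Bracket

/-! ### Values of rational functions -/

section Values
variable {n : ℕ} {f g : RatFn n} {z : Vars n → ℂ} {a b : ℂ}

theorem algebraMap_ne_zero_of_eval_ne_zero {Q : Pol n} (h : MvPolynomial.eval z Q ≠ 0) :
    algebraMap (Pol n) (RatFn n) Q ≠ 0 :=
  (map_ne_zero_iff _ (IsFractionRing.injective (Pol n) (RatFn n))).2 (by rintro rfl; simp at h)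

theorem hasValueAt_algebraMap (P : Pol n) (z : Vars n → ℂ) :
    HasValueAt (algebraMap (Pol n) (RatFn n) P) z (MvPolynomial.eval z P) :=
  ⟨P, 1, by simp, by simp, by simp⟩

theorem hasValueAt_X (z : Vars n → ℂ) (v : Vars n) : HasValueAt (X v) z (z v) := by
  simpa [X] using hasValueAt_algebraMap (MvPolynomial.X v) z

theorem hasValueAt_one (z : Vars n → ℂ) : HasValueAt (1 : RatFn n) z 1 := by
  simpa using hasValueAt_algebraMap (1 : Pol n) z

theorem HasValueAt.add (hf : HasValueAt f z a) (hg : HasValueAt g z b) :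
    HasValueAt (f + g) z (a + b) := by
  obtain ⟨P, Q, hQ, rfl, rfl⟩ := hf
  obtain ⟨P', Q', hQ', rfl, rfl⟩ := hg
  have h1 := algebraMap_ne_zero_of_eval_ne_zero hQ
  have h2 := algebraMap_ne_zero_of_eval_ne_zero hQ'
  refine ⟨P * Q' + Q * P', Q * Q', by simp [hQ, hQ'], ?_, ?_⟩
  · rw [div_add_div _ _ h1 h2]; simp
  · rw [div_add_div _ _ hQ hQ']; simp

theorem HasValueAt.mul (hf : HasValueAt f z a) (hg : HasValueAt g z b) :
    HasValueAt (f * g) z (a * b) := by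
  obtain ⟨P, Q, hQ, rfl, rfl⟩ := hf
  obtain ⟨P', Q', hQ', rfl, rfl⟩ := hg
  exact ⟨P * P', Q * Q', by simp [hQ, hQ'], by simp [div_mul_div_comm], by
    simp [div_mul_div_comm]⟩

theorem HasValueAt.neg (hf : HasValueAt f z a) : HasValueAt (-f) z (-a) := by
  obtain ⟨P, Q, hQ, rfl, rfl⟩ := hf
  exact ⟨-P, Q, hQ, by rw [map_neg]; exact (neg_div _ _).symm, by rw [map_neg, neg_div]⟩

theorem HasValueAt.sub (hf : HasValueAt f z a) (hg : HasValueAt g z b) :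
    HasValueAt (f - g) z (a - b) := by
  simpa [sub_eq_add_neg] using hf.add hg.neg

theorem HasValueAt.div (hf : HasValueAt f z a) (hg : HasValueAt g z b) (hb : b ≠ 0) :
    HasValueAt (f / g) z (a / b) := by
  obtain ⟨P, Q, hQ, rfl, rfl⟩ := hf
  obtain ⟨P', Q', hQ', rfl, rfl⟩ := hg
  have hP' : MvPolynomial.eval z P' ≠ 0 := (div_ne_zero_iff.1 hb).1
  exact ⟨P * Q', Q * P', by simp [hQ, hP'], by simp [div_div_div_eq], by simp [div_div_div_eq]⟩

theorem HasValueAt.den {c d : ℂ} {h k : RatFn n} (hf : HasValueAt f z a) (hg : HasValueAt g z b)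
    (hh : HasValueAt h z c) (hk : HasValueAt k z d) :
    HasValueAt (den f g h k) z (den a b c d) :=
  have h1 := hasValueAt_one z
  (((h1.sub hh).mul (h1.sub hk)).mul (hf.mul hg)).sub
    (((h1.sub hf).mul (h1.sub hg)).mul (hh.mul hk))

theorem HasValueAt.third {c d : ℂ} {h k : RatFn n} (hf : HasValueAt f z a) (hg : HasValueAt g z b)
    (hh : HasValueAt h z c) (hk : HasValueAt k z d) (hd : TripletPair.den a b c d ≠ 0) :
    HasValueAt (third f g h k) z (third a b c d) :=
  have h1 := hasValueAt_one z
  ((hh.mul hk).mul (((h1.sub hh).mul (h1.sub hk)).sub ((h1.sub hf).mul (h1.sub hg)))).div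
    (hf.den hg hh hk) hd

/-- The birational map `τ` is regular at `z` and maps it to `z'`. -/
def MapsPoint (τ : RatFn n ≃ₐ[ℂ] RatFn n) (z z' : Vars n → ℂ) : Prop :=
  ∀ v, HasValueAt (τ (X v)) z (z' v)

theorem MapsPoint.hasValueAt {τ : RatFn n ≃ₐ[ℂ] RatFn n} {z' : Vars n → ℂ}
    (h : MapsPoint τ z z') (hf : HasValueAt f z' a) : HasValueAt (τ f) z a := by
  have key : ∀ P : Pol n,
      HasValueAt (τ (algebraMap (Pol n) (RatFn n) P)) z (MvPolynomial.eval z' P) := by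
    intro P
    induction P using MvPolynomial.induction_on with
    | C c =>
      have e : algebraMap (Pol n) (RatFn n) (MvPolynomial.C c) = algebraMap ℂ (RatFn n) c :=
        (IsScalarTower.algebraMap_apply ℂ (Pol n) (RatFn n) c).symm
      rw [e, AlgEquiv.commutes, ← e]
      simpa using hasValueAt_algebraMap (MvPolynomial.C c) z
    | add P Q hP hQ => simpa using hP.add hQ
    | mul_X P v hP => simpa [X] using hP.mul (h v)
  obtain ⟨P, Q, hQ, rfl, rfl⟩ := hf
  rw [map_div₀]
  exact (key P).div (key Q) hQ

/-- Automorphisms of the function field act contravariantly on points: in `τ * τ'` the point is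
moved by `τ` first. -/
theorem MapsPoint.mul {τ τ' : RatFn n ≃ₐ[ℂ] RatFn n} {z z' z'' : Vars n → ℂ}
    (h : MapsPoint τ z z') (h' : MapsPoint τ' z' z'') : MapsPoint (τ * τ') z z'' :=
  fun v => h.hasValueAt (h' v)

theorem mapsPoint_omega (z : Vars n → ℂ) : MapsPoint (omega n) z fun v => z v.swap := by
  rintro (i | i)
  · change HasValueAt (omega n (x i)) z _
    rw [omega_x]
    exact hasValueAt_X z _
  · change HasValueAt (omega n (y i)) z _
    rw [omega_y]
    exact hasValueAt_X z _

theorem mapsPoint_sigma {j : Fin n} {z z' : Vars n → ℂ} (hy : ∀ i, z' (Sum.inr i) = z (Sum.inr i))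
    (hj : z' (Sum.inl j) = z (Sum.inl j))
    (hd : ∀ i, i ≠ j →
      den (z (Sum.inr j)) (z (Sum.inl i)) (z (Sum.inl j)) (z (Sum.inr i)) ≠ 0)
    (hx : ∀ i, i ≠ j → ∃ b, SystemFI (z (Sum.inr j)) (z (Sum.inl i)) (z' (Sum.inl i))
      (z (Sum.inl j)) (z (Sum.inr i)) b) : MapsPoint (sigma j) z z' := by
  rintro (i | i)
  · change HasValueAt (sigma j (x i)) z _
    rw [sigma_x, xbar]
    split_ifs with h
    · rw [h, hj]
      exact hasValueAt_X z _
    · obtain ⟨b, hb⟩ := hx i h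
      rw [((systemFI_iff (hd i h) _ _).1 hb).1]
      exact (hasValueAt_X z _).third (hasValueAt_X z _) (hasValueAt_X z _) (hasValueAt_X z _)
        (hd i h)
  · change HasValueAt (sigma j (y i)) z _
    rw [sigma_y, hy]
    exact hasValueAt_X z _

end Values

/-! ### Generic parameters -/

/-- The property `P` holds on a dense open set. -/
def Generic {E : Type*} [TopologicalSpace E] (P : E → Prop) : Prop :=
  ∃ U : Set E, IsOpen U ∧ Dense U ∧ ∀ p ∈ U, P p

namespace Generic
variable {E F : Type*} [TopologicalSpace E] [TopologicalSpace F] {P Q : E → Prop}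

theorem mono (hP : Generic P) (h : ∀ p, P p → Q p) : Generic Q :=
  let ⟨U, h1, h2, h3⟩ := hP
  ⟨U, h1, h2, fun p hp => h p (h3 p hp)⟩

theorem and (hP : Generic P) (hQ : Generic Q) : Generic fun p => P p ∧ Q p :=
  let ⟨U, h1, h2, h3⟩ := hP
  let ⟨V, k1, k2, k3⟩ := hQ
  ⟨U ∩ V, h1.inter k1, h2.inter_of_isOpen_left k2 h1, fun p hp => ⟨h3 p hp.1, k3 p hp.2⟩⟩

theorem all {ι : Type*} [Finite ι] {P : ι → E → Prop} (h : ∀ i, Generic (P i)) :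
    Generic fun p => ∀ i, P i p := by
  choose U h1 h2 h3 using h
  refine ⟨⋂ i, U i, isOpen_iInter_of_finite h1, ?_, fun p hp i => h3 i p (mem_iInter.1 hp i)⟩
  have : (range U).Finite := finite_range U
  rw [← sInter_range]
  exact this.dense_sInter (by rintro _ ⟨i, rfl⟩; exact h1 i) (by rintro _ ⟨i, rfl⟩; exact h2 i)

theorem imp {a : Prop} (h : a → Generic P) : Generic fun p => a → P p := by
  by_cases ha : a
  · exact (h ha).mono fun p hp _ => hp
  · exact ⟨univ, isOpen_univ, dense_univ, fun _ _ h => (ha h).elim⟩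

theorem comp {P : F → Prop} (h : Generic P) {T : E → F} (hT : Continuous T) (hT' : IsOpenMap T) :
    Generic fun p => P (T p) :=
  let ⟨U, h1, h2, h3⟩ := h
  ⟨T ⁻¹' U, h1.preimage hT, h2.preimage hT', fun _ hp => h3 _ hp⟩

end Generic

theorem isOpenMap_of_involutive {E : Type*} [TopologicalSpace E] {T : E → E} (hT : Continuous T)
    (hi : Function.Involutive T) : IsOpenMap T :=
  (Homeomorph.mk hi.toPerm hT hT).isOpenMap

/-- A nonzero linear form is surjective, hence open, so it pulls back the dense open set where the
bracket is nonzero to a dense open set. The point `q` only certifies that the form is nonzero. -/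
theorem Bracket.generic_fn_ne_zero (br : Bracket) {n : ℕ} (l : Params n →ₗ[ℂ] ℂ) {q : Params n}
    (hq : l q ≠ 0) : Generic fun p => br.fn (l p) ≠ 0 := by
  have hs : Function.Surjective l := LinearMap.surjective fun h => hq (by simp [h])
  have hc : Continuous l := l.continuous_of_finiteDimensional
  exact Generic.comp ⟨{u | br.fn u ≠ 0}, br.continuous_fn.isOpen_preimage _ isOpen_ne,
    br.dense_fn_ne_zero, fun _ h => h⟩ hc (LinearMap.isOpenMap_of_finiteDimensional l hs)

/-! ### Generic parameters, and the passage from generic to all admissible parameters. -/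

section GenericPoints
variable (br : Bracket) {n : ℕ}

/-- The brackets that occur in the action of the maps `σ_j` do not vanish at `p`. -/
structure Good (p : Params n) : Prop where
  h : br.fn (p.1 0 - p.1 1) ≠ 0
  k : ∀ a b, a ≠ b → br.fn (p.2 a - p.2 b) ≠ 0
  hk : ∀ s a b, br.fn (p.1 s - p.2 a - p.2 b) ≠ 0
  hhk : ∀ a b c d, br.fn (p.1 0 + p.1 1 - p.2 a - p.2 b - p.2 c - p.2 d) ≠ 0

theorem generic_good : Generic fun p : Params n => Good br p := by
  let lh : Fin 2 → Params n →ₗ[ℂ] ℂ := fun s => (LinearMap.proj s).comp (LinearMap.fst ℂ _ _)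
  let lk : Fin (n + 3) → Params n →ₗ[ℂ] ℂ := fun a =>
    (LinearMap.proj a).comp (LinearMap.snd ℂ _ _)
  have h1 : Generic fun p : Params n => br.fn (p.1 0 - p.1 1) ≠ 0 :=
    br.generic_fn_ne_zero (lh 0 - lh 1) (q := (![1, 0], 0)) (by simp [lh])
  have h2 : Generic fun p : Params n => ∀ a b, a ≠ b → br.fn (p.2 a - p.2 b) ≠ 0 :=
    .all fun a => .all fun b => .imp fun hab =>
      br.generic_fn_ne_zero (lk a - lk b) (q := (0, Pi.single a 1)) (by simp [lk, hab.symm])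
  -- No distinctness of indices is needed here or in `h4`: at `h = (1, 1)`, `k = 0` these forms are
  -- nonzero in any case.
  have h3 : Generic fun p : Params n => ∀ s a b, br.fn (p.1 s - p.2 a - p.2 b) ≠ 0 :=
    .all fun s => .all fun a => .all fun b =>
      br.generic_fn_ne_zero (lh s - lk a - lk b) (q := (1, 0)) (by simp [lh, lk])
  have h4 : Generic fun p : Params n =>
      ∀ a b c d, br.fn (p.1 0 + p.1 1 - p.2 a - p.2 b - p.2 c - p.2 d) ≠ 0 :=
    .all fun a => .all fun b => .all fun c => .all fun d =>
      br.generic_fn_ne_zero (lh 0 + lh 1 - lk a - lk b - lk c - lk d) (q := (1, 0))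
        (by simp [lh, lk])
  exact ((h1.and h2).and (h3.and h4)).mono fun p h => ⟨h.1.1, h.1.2, h.2.1, h.2.2⟩

theorem Good.admissible {p : Params n} (h : Good br p) : Admissible br p := by
  rintro a ha
  refine ⟨mul_ne_zero (h.k _ _ ?_) (h.hk _ _ _), fun i => mul_ne_zero (h.k _ _ ?_) (h.hk _ _ _)⟩
  · simp
  · simp

/-- The birational map `τ` maps the point parametrized by `p` to that parametrized by `T p`,
generically. -/
def GenericallyMaps (τ : RatFn n ≃ₐ[ℂ] RatFn n) (T : Params n → Params n) : Prop :=
  Generic fun p => MapsPoint τ (param br p) (param br (T p))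

variable {br}

theorem GenericallyMaps.mul {τ τ' : RatFn n ≃ₐ[ℂ] RatFn n} {T T' : Params n → Params n}
    (h : GenericallyMaps br τ T) (h' : GenericallyMaps br τ' T') (hT : Continuous T)
    (hT' : IsOpenMap T) : GenericallyMaps br (τ * τ') (T' ∘ T) :=
  (h.and (h'.comp hT hT')).mono fun _ hp => hp.1.mul hp.2

theorem continuousAt_param {p : Params n} (hp : Admissible br p) (v : Vars n) :
    ContinuousAt (fun p => param br p v) p := by
  have hk : ∀ a i j ha hi hj, Continuous fun p : Params n => coeff br p a i j ha hi hj := by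
    intro a i j ha hi hj
    have := br.continuous_fn
    unfold coeff hh kk
    fun_prop
  rcases v with i | i
  · exact ContinuousAt.div ((hk ..).mul (hk ..)).continuousAt ((hk ..).mul (hk ..)).continuousAt
      (mul_ne_zero (hp 1 (by omega)).1 ((hp 1 (by omega)).2 i))
  · exact ContinuousAt.div ((hk ..).mul (hk ..)).continuousAt ((hk ..).mul (hk ..)).continuousAt
      (mul_ne_zero (hp 2 (by omega)).1 ((hp 2 (by omega)).2 i))

/-- At any admissible `p` with `T p` admissible, both the regular rational function and the
coordinate of the image depend continuously on the parameters. They agree on a dense set, so their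
limits at `p` along that set agree. -/
theorem GenericallyMaps.compatible {τ : RatFn n ≃ₐ[ℂ] RatFn n} {T : Params n →ₗ[ℂ] Params n}
    (h : GenericallyMaps br τ T) (hT' : IsOpenMap T) : Compatible br τ T := by
  have hT : Continuous T := T.continuous_of_finiteDimensional
  have hg := generic_good (n := n) br
  refine ⟨((hg.and (hg.comp hT hT')).and h).mono fun p hp =>
    ⟨hp.1.1.admissible, hp.1.2.admissible, fun v => ⟨_, hp.2 v⟩⟩, fun p hp hTp v w hw => ?_⟩
  obtain ⟨U, -, hU, hUm⟩ := h
  obtain ⟨P, Q, hQ, hPQ, rfl⟩ := hw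
  have hc : ∀ P : Pol n, ContinuousAt (fun q => MvPolynomial.eval (param br q) P) p := fun P =>
    (MvPolynomial.continuous_eval P).continuousAt.comp
      (f := fun q => param br q) (continuousAt_pi.2 fun v => continuousAt_param hp v)
  have hc1 : ContinuousAt (fun q => MvPolynomial.eval (param br q) P /
    MvPolynomial.eval (param br q) Q) p := (hc P).div (hc Q) hQ
  have hc2 : ContinuousAt (fun q => param br (T q) v) p :=
    (continuousAt_param hTp v).comp hT.continuousAt
  have : (𝓝[U] p).NeBot := mem_closure_iff_nhdsWithin_neBot.1 (hU p)
  refine tendsto_nhds_unique_of_eventuallyEq (l := 𝓝[U] p) (hc1.mono_left nhdsWithin_le_nhds)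
    (hc2.mono_left nhdsWithin_le_nhds) ?_
  filter_upwards [self_mem_nhdsWithin, nhdsWithin_le_nhds ((hc Q).eventually_ne hQ)] with q hq hq'
  exact HasValueAt.unique ⟨P, Q, hq', hPQ, rfl⟩ (hUm q hq v)

end GenericPoints

/-! ### Cross-ratios -/

section CrossRatio
variable (f : ℂ → ℂ)

/-- The bracket `[k - l][h - k - l]`. -/
def pair (h k l : ℂ) : ℂ := f (k - l) * f (h - k - l)

/-- The cross-ratio of the arguments `k₁, k₂, k₃, k`. -/
noncomputable def crossRatio (k₁ k₂ k₃ h k : ℂ) : ℂ :=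
  pair f h k₁ k₃ * pair f h k₂ k / (pair f h k₂ k₃ * pair f h k₁ k)

variable {f}

theorem pair_sub (odd : ∀ u, f (-u) = -f u) (h k l : ℂ) : pair f h k (h - l) = pair f h k l := by
  simp only [pair]
  rw [show k - (h - l) = -(h - k - l) by ring, show h - k - (h - l) = -(k - l) by ring, odd, odd]
  ring

theorem crossRatio_sub (odd : ∀ u, f (-u) = -f u) (k₁ k₂ k₃ h k : ℂ) :
    crossRatio f k₁ k₂ k₃ h (h - k) = crossRatio f k₁ k₂ k₃ h k := by
  simp only [crossRatio, pair_sub odd]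

/-- This is the three-term relation at the four arguments `h/2 - k_i`, whose sums and differences
are the arguments of the brackets in `pair`, up to sign. -/
theorem pair_plucker (odd : ∀ u, f (-u) = -f u) (three : ∀ a b c d, threeTerm f a b c d = 0)
    (h k₁ k₂ k₃ k₄ : ℂ) :
    pair f h k₁ k₂ * pair f h k₃ k₄ - pair f h k₁ k₃ * pair f h k₂ k₄ +
      pair f h k₂ k₃ * pair f h k₁ k₄ = 0 := by
  have e := three (h / 2 - k₁) (h / 2 - k₂) (h / 2 - k₃) (h / 2 - k₄)
  have s : ∀ k l : ℂ, h / 2 - k + (h / 2 - l) = h - k - l := fun k l => by ring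
  have d : ∀ k l : ℂ, f (h / 2 - k - (h / 2 - l)) = -f (k - l) := fun k l => by
    rw [← odd]; congr 1; ring
  simp only [threeTerm, s, d] at e
  have e1 : f (k₄ - k₂) = -f (k₂ - k₄) := by rw [← odd, neg_sub]
  rw [e1, show h - k₄ - k₂ = h - k₂ - k₄ by ring] at e
  simp only [pair]
  linear_combination e

theorem one_sub_crossRatio (odd : ∀ u, f (-u) = -f u)
    (three : ∀ a b c d, threeTerm f a b c d = 0) {k₁ k₂ k₃ h k : ℂ}
    (h1 : pair f h k₂ k₃ ≠ 0) (h2 : pair f h k₁ k ≠ 0) :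
    1 - crossRatio f k₁ k₂ k₃ h k =
      -(pair f h k₁ k₂ * pair f h k₃ k) / (pair f h k₂ k₃ * pair f h k₁ k) := by
  rw [crossRatio, eq_div_iff (mul_ne_zero h1 h2), sub_mul, div_mul_cancel₀ _ (mul_ne_zero h1 h2)]
  linear_combination pair_plucker odd three h k₁ k₂ k₃ k

/-- Written out, both sides are products of the same six brackets; only oddness is used. -/
theorem pair_triple (odd : ∀ u, f (-u) = -f u) (h₁ h₂ k l m : ℂ) :
    pair f h₂ k l * pair f h₁ k m * pair f (h₁ + h₂ - l - m) k (h₁ - l) =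
      pair f h₁ k l * pair f h₂ k m * pair f (h₁ + h₂ - l - m) k (h₂ - l) := by
  simp only [pair]
  rw [show k - (h₁ - l) = -(h₁ - k - l) by ring, show k - (h₂ - l) = -(h₂ - k - l) by ring,
    show h₁ + h₂ - l - m - k - (h₁ - l) = h₂ - k - m by ring,
    show h₁ + h₂ - l - m - k - (h₂ - l) = h₁ - k - m by ring, odd, odd]
  ring

/-- `pair_triple` is used at three values of `k`: at `k₂` for the numerators of the cross-ratios, at
`k₃` for those of `1 -` cross-ratio, and at `k₁` for the denominators common to both. -/
theorem systemFI_crossRatio (odd : ∀ u, f (-u) = -f u)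
    (three : ∀ a b c d, threeTerm f a b c d = 0) {k₁ k₂ k₃ h₁ h₂ l m : ℂ}
    (n1 : pair f h₁ k₂ k₃ ≠ 0) (n2 : pair f h₂ k₂ k₃ ≠ 0)
    (n3 : pair f (h₁ + h₂ - l - m) k₂ k₃ ≠ 0) (n4 : pair f h₁ k₁ l ≠ 0)
    (n5 : pair f h₂ k₁ l ≠ 0) (n6 : pair f h₁ k₁ m ≠ 0) (n7 : pair f h₂ k₁ m ≠ 0)
    (n8 : pair f (h₁ + h₂ - l - m) k₁ (h₁ - l) ≠ 0)
    (n9 : pair f (h₁ + h₂ - l - m) k₁ (h₂ - l) ≠ 0) :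
    SystemFI (crossRatio f k₁ k₂ k₃ h₂ l) (crossRatio f k₁ k₂ k₃ h₁ m)
      (crossRatio f k₁ k₂ k₃ (h₁ + h₂ - l - m) (h₁ - l)) (crossRatio f k₁ k₂ k₃ h₁ l)
      (crossRatio f k₁ k₂ k₃ h₂ m) (crossRatio f k₁ k₂ k₃ (h₁ + h₂ - l - m) (h₂ - l)) := by
  have t := fun k => pair_triple odd h₁ h₂ k l m
  constructor
  · simp only [one_sub_crossRatio odd three, n1, n2, n3, n4, n5, n6, n7, n8, n9, ne_eq,
      not_false_eq_true, div_mul_div_comm]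
    congr 1
    · linear_combination (-(pair f h₁ k₁ k₂ * pair f h₂ k₁ k₂ *
        pair f (h₁ + h₂ - l - m) k₁ k₂)) * t k₃
    · linear_combination (pair f h₁ k₂ k₃ * pair f h₂ k₂ k₃ *
        pair f (h₁ + h₂ - l - m) k₂ k₃) * t k₁
  · simp only [crossRatio, div_mul_div_comm]
    congr 1
    · linear_combination (pair f h₁ k₁ k₃ * pair f h₂ k₁ k₃ *
        pair f (h₁ + h₂ - l - m) k₁ k₃) * t k₂
    · linear_combination (pair f h₁ k₂ k₃ * pair f h₂ k₂ k₃ *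
        pair f (h₁ + h₂ - l - m) k₂ k₃) * t k₁

theorem crossRatio_ne (odd : ∀ u, f (-u) = -f u)
    (three : ∀ a b c d, threeTerm f a b c d = 0) {k₁ k₂ k₃ h k l : ℂ}
    (n12 : pair f h k₁ k₂ ≠ 0) (n13 : pair f h k₁ k₃ ≠ 0) (n23 : pair f h k₂ k₃ ≠ 0)
    (nk : pair f h k₁ k ≠ 0) (nl : pair f h k₁ l ≠ 0) (nkl : pair f h k l ≠ 0) :
    crossRatio f k₁ k₂ k₃ h k ≠ crossRatio f k₁ k₂ k₃ h l := by
  intro e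
  rw [crossRatio, crossRatio, div_eq_div_iff (mul_ne_zero n23 nk) (mul_ne_zero n23 nl)] at e
  refine mul_ne_zero (mul_ne_zero n13 n23) (mul_ne_zero n12 nkl) ?_
  linear_combination pair f h k₁ k₃ * pair f h k₂ k₃ * pair_plucker odd three h k₁ k₂ k l - e

/-- Cross-ratios with the same `k`, but with different `h`, are different in general. -/
theorem crossRatio_ne' (odd : ∀ u, f (-u) = -f u)
    (three : ∀ a b c d, threeTerm f a b c d = 0) {k₁ k₂ k₃ h₁ h₂ k : ℂ}
    (n13 : f (k₁ - k₃) ≠ 0) (n2k : f (k₂ - k) ≠ 0)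
    (nd1 : pair f h₁ k₂ k₃ * pair f h₁ k₁ k ≠ 0) (nd2 : pair f h₂ k₂ k₃ * pair f h₂ k₁ k ≠ 0)
    (n12 : f (k₁ - k₂) ≠ 0) (n3k : f (k₃ - k) ≠ 0) (nh : f (h₁ - h₂) ≠ 0)
    (n : f (h₁ + h₂ - k₁ - k₂ - k₃ - k) ≠ 0) :
    crossRatio f k₁ k₂ k₃ h₂ k ≠ crossRatio f k₁ k₂ k₃ h₁ k := by
  intro e
  have n23 : f (k₂ - k₃) ≠ 0 := fun h => nd1 (by simp [pair, h])
  have n1k : f (k₁ - k) ≠ 0 := fun h => nd1 (by simp [pair, h])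
  rw [crossRatio, crossRatio, div_eq_div_iff nd2 nd1] at e
  -- With this `h` and these four arguments, the last two terms of the Plücker relation give the
  -- difference of the cross-multiplied cross-ratios, up to a common factor; the first term is the
  -- product of the brackets assumed nonzero in the last four hypotheses.
  have p := pair_plucker odd three (h₁ + h₂ - k₁ - k₂) (h₂ - k₁) (h₂ - k₂) k₃ k
  simp only [pair] at e p
  have s1 : f (h₂ - k₁ - (h₂ - k₂)) = -f (k₁ - k₂) := by rw [← odd]; congr 1; ring
  rw [s1, show h₁ + h₂ - k₁ - k₂ - (h₂ - k₁) - (h₂ - k₂) = h₁ - h₂ by ring,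
    show h₁ + h₂ - k₁ - k₂ - (h₂ - k₁) - k₃ = h₁ - k₂ - k₃ by ring,
    show h₁ + h₂ - k₁ - k₂ - (h₂ - k₂) - k = h₁ - k₁ - k by ring,
    show h₁ + h₂ - k₁ - k₂ - (h₂ - k₂) - k₃ = h₁ - k₁ - k₃ by ring,
    show h₁ + h₂ - k₁ - k₂ - (h₂ - k₁) - k = h₁ - k₂ - k by ring] at p
  refine mul_ne_zero (mul_ne_zero (mul_ne_zero n13 n2k) (mul_ne_zero n23 n1k))
    (mul_ne_zero (mul_ne_zero n12 nh) (mul_ne_zero n3k n)) ?_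
  linear_combination -(f (k₁ - k₃) * f (k₂ - k) * (f (k₂ - k₃) * f (k₁ - k))) * p - e

end CrossRatio

/-! ### The system at a point -/

section System
variable {K : Type*} [Field K] {a₀ a₁ a₂ b₀ b₁ b₂ : K}

/-- If the denominator vanished, the system would force `a₀a₁ = b₀b₁`, and then the product equation
would give `a₂ = b₂`. -/
theorem SystemFI.den_ne_zero (h : SystemFI a₀ a₁ a₂ b₀ b₁ b₂) (ha₀ : a₀ ≠ 0) (ha₁ : a₁ ≠ 0)
    (hb₀ : 1 - b₀ ≠ 0) (hb₁ : 1 - b₁ ≠ 0) (hne : a₂ ≠ b₂) : den a₀ a₁ b₀ b₁ ≠ 0 := by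
  obtain ⟨h1, h2⟩ := h
  intro hd
  unfold den at hd
  have e : a₀ * a₁ = b₀ * b₁ := by
    apply mul_left_cancel₀ (mul_ne_zero hb₀ hb₁)
    linear_combination (1 - a₂) * hd + (1 - b₀) * (1 - b₁) * h2 + b₀ * b₁ * h1
  apply hne
  apply mul_left_cancel₀ (mul_ne_zero ha₀ ha₁)
  rw [h2, e]

/-- This factorization controls the denominator met when the system is solved back for `a₁`, that
is, when the involution `σ_j` is applied at an image point. -/
theorem den_third_mul_den (h : den a₀ a₁ b₀ b₁ ≠ 0) :
    den a₀ (third a₀ a₁ b₀ b₁) b₀ b₁ * den a₀ a₁ b₀ b₁ =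
      b₀ * b₁ * (1 - b₀) * (1 - b₁) * (a₀ - b₀) * (a₀ - b₁) := by
  have hx : third a₀ a₁ b₀ b₁ * den a₀ a₁ b₀ b₁ =
      b₀ * b₁ * ((1 - b₀) * (1 - b₁) - (1 - a₀) * (1 - a₁)) := div_mul_cancel₀ _ h
  have : den a₀ (third a₀ a₁ b₀ b₁) b₀ b₁ =
      third a₀ a₁ b₀ b₁ * ((1 - b₀) * (1 - b₁) * a₀ + (1 - a₀) * (b₀ * b₁)) -
        (1 - a₀) * (b₀ * b₁) := by
    unfold den; ring
  rw [this, sub_mul, mul_right_comm, hx]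
  unfold den
  ring

theorem SystemFI.den_ne_zero' (h : SystemFI a₀ a₁ a₂ b₀ b₁ b₂) (hd : den a₀ a₁ b₀ b₁ ≠ 0)
    (hb₀ : b₀ ≠ 0) (hb₁ : b₁ ≠ 0) (hb₀' : 1 - b₀ ≠ 0) (hb₁' : 1 - b₁ ≠ 0) (h0 : a₀ ≠ b₀)
    (h1 : a₀ ≠ b₁) : den a₀ a₂ b₀ b₁ ≠ 0 := by
  have e := den_third_mul_den hd
  rw [← ((systemFI_iff hd _ _).1 h).1] at e
  refine left_ne_zero_of_mul (b := den a₀ a₁ b₀ b₁) ?_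
  rw [e]
  simp [hb₀, hb₁, hb₀', hb₁', sub_ne_zero.2 h0, sub_ne_zero.2 h1]

end System

/-! ### The maps on the parametrized points -/

variable (br : Bracket) {n : ℕ}

theorem param_inl (p : Params n) (i : Fin n) : param br p (Sum.inl i) =
    crossRatio br.fn (kk p 1) (kk p 2) (kk p 3) (hh p 1) (kk p (i.val + 4)) := rfl

theorem param_inr (p : Params n) (i : Fin n) : param br p (Sum.inr i) =
    crossRatio br.fn (kk p 1) (kk p 2) (kk p 3) (hh p 2) (kk p (i.val + 4)) := rfl

/-- The image of the point parametrized by `p` under `σ_j`. -/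
noncomputable def sigmaParam (j : Fin n) (p : Params n) : Vars n → ℂ
  | Sum.inl i => if i = j then param br p (Sum.inl j) else
      crossRatio br.fn (kk p 1) (kk p 2) (kk p 3)
        (hh p 1 + hh p 2 - kk p (j.val + 4) - kk p (i.val + 4)) (hh p 1 - kk p (j.val + 4))
  | Sum.inr i => param br p (Sum.inr i)

/-! ### The maps `σ_j` at generic parametrized points. -/

section Sigma
variable {br}

theorem Good.pair_ne_zero {p : Params n} (hp : Good br p) (s : Fin 2) {a b : Fin (n + 3)}
    (hab : a ≠ b) : pair br.fn (p.1 s) (p.2 a) (p.2 b) ≠ 0 :=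
  mul_ne_zero (hp.k _ _ hab) (hp.hk _ _ _)

theorem Good.pair_ne_zero' {p : Params n} (hp : Good br p) {a b : Fin (n + 3)} (c d : Fin (n + 3))
    (hab : a ≠ b) : pair br.fn (p.1 0 + p.1 1 - p.2 c - p.2 d) (p.2 a) (p.2 b) ≠ 0 := by
  exact mul_ne_zero (hp.k _ _ hab) (hp.hhk c d a b)

theorem Good.pair_ne_zero₁ {p : Params n} (hp : Good br p) (a c d : Fin (n + 3)) :
    pair br.fn (p.1 0 + p.1 1 - p.2 c - p.2 d) (p.2 a) (p.1 0 - p.2 c) ≠ 0 := by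
  rw [pair, show p.2 a - (p.1 0 - p.2 c) = -(p.1 0 - p.2 a - p.2 c) by ring, br.fn_neg,
    show p.1 0 + p.1 1 - p.2 c - p.2 d - p.2 a - (p.1 0 - p.2 c) = p.1 1 - p.2 a - p.2 d by ring]
  exact mul_ne_zero (neg_ne_zero.2 (hp.hk _ _ _)) (hp.hk _ _ _)

theorem Good.pair_ne_zero₂ {p : Params n} (hp : Good br p) (a c d : Fin (n + 3)) :
    pair br.fn (p.1 0 + p.1 1 - p.2 c - p.2 d) (p.2 a) (p.1 1 - p.2 c) ≠ 0 := by
  rw [pair, show p.2 a - (p.1 1 - p.2 c) = -(p.1 1 - p.2 a - p.2 c) by ring, br.fn_neg,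
    show p.1 0 + p.1 1 - p.2 c - p.2 d - p.2 a - (p.1 1 - p.2 c) = p.1 0 - p.2 a - p.2 d by ring]
  exact mul_ne_zero (neg_ne_zero.2 (hp.hk _ _ _)) (hp.hk _ _ _)

theorem Good.exists_systemFI {p : Params n} (hp : Good br p) {i j : Fin n} (hij : i ≠ j) :
    ∃ b, SystemFI (param br p (Sum.inr j)) (param br p (Sum.inl i)) (sigmaParam br j p (Sum.inl i))
        (param br p (Sum.inl j)) (param br p (Sum.inr i)) b ∧
      den (param br p (Sum.inr j)) (param br p (Sum.inl i)) (param br p (Sum.inl j))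
        (param br p (Sum.inr i)) ≠ 0 ∧
      den (param br p (Sum.inr j)) (sigmaParam br j p (Sum.inl i)) (param br p (Sum.inl j))
        (param br p (Sum.inr i)) ≠ 0 := by
  have odd := br.fn_neg
  have three := br.threeTerm_fn
  -- The indices stay opaque until the final `subst`. They are zero-based: position `j.val + 3`
  -- holds the parameter `kk p (j.val + 4)`.
  obtain ⟨k₁, hk₁⟩ : ∃ a : Fin (n + 3), a = ⟨0, by omega⟩ := ⟨_, rfl⟩
  obtain ⟨k₂, hk₂⟩ : ∃ a : Fin (n + 3), a = ⟨1, by omega⟩ := ⟨_, rfl⟩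
  obtain ⟨k₃, hk₃⟩ : ∃ a : Fin (n + 3), a = ⟨2, by omega⟩ := ⟨_, rfl⟩
  obtain ⟨l, hl⟩ : ∃ a : Fin (n + 3), a = ⟨j.val + 3, by omega⟩ := ⟨_, rfl⟩
  obtain ⟨m, hm⟩ : ∃ a : Fin (n + 3), a = ⟨i.val + 3, by omega⟩ := ⟨_, rfl⟩
  have hij' : i.val ≠ j.val := fun h => hij (Fin.ext h)
  have e12 : k₁ ≠ k₂ := by simp [hk₁, hk₂]
  have e13 : k₁ ≠ k₃ := by simp [hk₁, hk₃]
  have e23 : k₂ ≠ k₃ := by simp [hk₂, hk₃]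
  have e1l : k₁ ≠ l := by simp [hk₁, hl]
  have e2l : k₂ ≠ l := by simp [hk₂, hl]
  have e3l : k₃ ≠ l := by simp [hk₃, hl]
  have e1m : k₁ ≠ m := by simp [hk₁, hm]
  have e2m : k₂ ≠ m := by simp [hk₂, hm]
  have e3m : k₃ ≠ m := by simp [hk₃, hm]
  have elm : l ≠ m := by simp [hl, hm, hij'.symm]
  have ex : ∀ s c, c = l ∨ c = m → crossRatio br.fn (p.2 k₁) (p.2 k₂) (p.2 k₃) (p.1 s) (p.2 c) ≠ 0 ∧
      1 - crossRatio br.fn (p.2 k₁) (p.2 k₂) (p.2 k₃) (p.1 s) (p.2 c) ≠ 0 := by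
    intro s c hc
    have e1c : k₁ ≠ c := by rcases hc with rfl | rfl <;> assumption
    have e2c : k₂ ≠ c := by rcases hc with rfl | rfl <;> assumption
    have e3c : k₃ ≠ c := by rcases hc with rfl | rfl <;> assumption
    rw [one_sub_crossRatio odd three (hp.pair_ne_zero s e23) (hp.pair_ne_zero s e1c), crossRatio]
    have hd := mul_ne_zero (hp.pair_ne_zero s e23) (hp.pair_ne_zero s e1c)
    exact ⟨div_ne_zero (mul_ne_zero (hp.pair_ne_zero s e13) (hp.pair_ne_zero s e2c)) hd,
      div_ne_zero (neg_ne_zero.2 (mul_ne_zero (hp.pair_ne_zero s e12) (hp.pair_ne_zero s e3c))) hd⟩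
  have sys := systemFI_crossRatio (f := br.fn) odd three (k₁ := p.2 k₁) (k₂ := p.2 k₂)
    (k₃ := p.2 k₃) (h₁ := p.1 0) (h₂ := p.1 1) (l := p.2 l) (m := p.2 m)
    (hp.pair_ne_zero 0 e23) (hp.pair_ne_zero 1 e23) (hp.pair_ne_zero' l m e23)
    (hp.pair_ne_zero 0 e1l) (hp.pair_ne_zero 1 e1l) (hp.pair_ne_zero 0 e1m)
    (hp.pair_ne_zero 1 e1m) (hp.pair_ne_zero₁ k₁ l m) (hp.pair_ne_zero₂ k₁ l m)
  have hne : crossRatio br.fn (p.2 k₁) (p.2 k₂) (p.2 k₃) (p.1 0 + p.1 1 - p.2 l - p.2 m)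
      (p.1 0 - p.2 l) ≠ crossRatio br.fn (p.2 k₁) (p.2 k₂) (p.2 k₃)
        (p.1 0 + p.1 1 - p.2 l - p.2 m) (p.1 1 - p.2 l) := by
    refine crossRatio_ne odd three (hp.pair_ne_zero' l m e12) (hp.pair_ne_zero' l m e13)
      (hp.pair_ne_zero' l m e23) (hp.pair_ne_zero₁ k₁ l m) (hp.pair_ne_zero₂ k₁ l m) ?_
    rw [pair, show p.1 0 - p.2 l - (p.1 1 - p.2 l) = p.1 0 - p.1 1 by ring,
      show p.1 0 + p.1 1 - p.2 l - p.2 m - (p.1 0 - p.2 l) - (p.1 1 - p.2 l) = p.2 l - p.2 m by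
        ring]
    exact mul_ne_zero hp.h (hp.k _ _ elm)
  have hd := sys.den_ne_zero (ex 1 l (.inl rfl)).1 (ex 0 m (.inr rfl)).1 (ex 0 l (.inl rfl)).2
    (ex 1 m (.inr rfl)).2 hne
  -- The two inequalities required are `y_j ≠ x_j` (same `k`, different `h`) and `y_j ≠ y_i` (same
  -- `h`, different `k`).
  have hd' := sys.den_ne_zero' hd (ex 0 l (.inl rfl)).1 (ex 1 m (.inr rfl)).1
    (ex 0 l (.inl rfl)).2 (ex 1 m (.inr rfl)).2
    (crossRatio_ne' odd three (hp.k _ _ e13) (hp.k _ _ e2l)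
      (mul_ne_zero (hp.pair_ne_zero 0 e23) (hp.pair_ne_zero 0 e1l))
      (mul_ne_zero (hp.pair_ne_zero 1 e23) (hp.pair_ne_zero 1 e1l)) (hp.k _ _ e12)
      (hp.k _ _ e3l) hp.h (hp.hhk _ _ _ _))
    (crossRatio_ne odd three (hp.pair_ne_zero 1 e12) (hp.pair_ne_zero 1 e13)
      (hp.pair_ne_zero 1 e23) (hp.pair_ne_zero 1 e1l) (hp.pair_ne_zero 1 e1m)
      (hp.pair_ne_zero 1 elm))
  subst hk₁ hk₂ hk₃ hl hm
  rw [sigmaParam, if_neg hij]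
  exact ⟨_, sys, hd, hd'⟩

theorem SystemFI.symm {K : Type*} [Field K] {a₀ a₁ a₂ b₀ b₁ b₂ : K}
    (h : SystemFI a₀ a₁ a₂ b₀ b₁ b₂) : ∃ b, SystemFI a₀ a₂ a₁ b₀ b₁ b :=
  ⟨b₂, by rw [mul_right_comm]; exact h.1, by rw [mul_right_comm]; exact h.2⟩

theorem Good.mapsPoint_sigma {p : Params n} (hp : Good br p) (j : Fin n) :
    MapsPoint (sigma j) (param br p) (sigmaParam br j p) := by
  refine TripletPair.mapsPoint_sigma (fun i => rfl) (by simp [sigmaParam]) (fun i hi => ?_)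
    fun i hi => ?_
  · obtain ⟨b, -, h, -⟩ := hp.exists_systemFI hi
    exact h
  · obtain ⟨b, h, -⟩ := hp.exists_systemFI hi
    exact ⟨b, h⟩

/-- The system is symmetric in the second and third members of a triplet, so the equations that send
`x_i` to its image also send it back, once the denominator at the image is nonzero. -/
theorem Good.mapsPoint_sigma' {p : Params n} (hp : Good br p) (j : Fin n) :
    MapsPoint (sigma j) (sigmaParam br j p) (param br p) := by
  have hj : sigmaParam br j p (Sum.inl j) = param br p (Sum.inl j) := by simp [sigmaParam]
  refine TripletPair.mapsPoint_sigma (fun i => rfl) hj.symm (fun i hi => ?_) fun i hi => ?_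
  · obtain ⟨b, -, -, h⟩ := hp.exists_systemFI hi
    rwa [hj]
  · obtain ⟨b, h, -⟩ := hp.exists_systemFI hi
    rw [hj]
    exact h.symm

end Sigma

/-! ### The product of two maps `σ` -/

/-- The action of `σ_a σ_b` on the parameters:
`h₁ ↦ h₁ + h₂ - k_a - k_b`, `k_a ↦ h₂ - k_a`, `k_b ↦ h₂ - k_b`. -/
noncomputable def linSigma (a b : Fin n) (p : Params n) : Params n :=
  (![hh p 1 + hh p 2 - kk p (a.val + 4) - kk p (b.val + 4), hh p 2],
    fun l => if l.val = a.val + 3 ∨ l.val = b.val + 3 then hh p 2 - p.2 l else p.2 l)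

section LinSigma
variable (a b : Fin n) (p : Params n)

theorem hh_one_linSigma : hh (linSigma a b p) 1 =
    hh p 1 + hh p 2 - kk p (a.val + 4) - kk p (b.val + 4) := rfl

theorem hh_two_linSigma : hh (linSigma a b p) 2 = hh p 2 := rfl

theorem kk_linSigma (i : ℕ) (hi : 1 ≤ i ∧ i ≤ n + 3) : kk (linSigma a b p) i hi =
    if i = a.val + 4 ∨ i = b.val + 4 then hh p 2 - kk p i hi else kk p i hi := by
  obtain ⟨i, rfl⟩ : ∃ j, i = j + 1 := ⟨i - 1, by omega⟩
  simp [kk, linSigma]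

end LinSigma

theorem params_ext {p q : Params n} (h1 : hh p 1 = hh q 1) (h2 : hh p 2 = hh q 2)
    (hk : ∀ i (hi : 1 ≤ i ∧ i ≤ n + 3), kk p i hi = kk q i hi) : p = q := by
  refine Prod.ext (funext fun s => ?_) (funext fun i => hk (i.val + 1) (by omega))
  fin_cases s
  · exact h1
  · exact h2

theorem continuous_linSigma (a b : Fin n) : Continuous (linSigma a b) := by
  refine Continuous.prodMk (continuous_pi fun s => ?_) (continuous_pi fun l => ?_)
  · unfold hh kk
    fin_cases s
    · simp only [Fin.zero_eta, Matrix.cons_val_zero]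
      fun_prop
    · simp only [Fin.mk_one, Matrix.cons_val_one]
      fun_prop
  · unfold hh
    split_ifs <;> fun_prop

theorem linSigma_involutive {a b : Fin n} (hab : a ≠ b) : Function.Involutive (linSigma a b) := by
  intro p
  have hab' : a.val ≠ b.val := fun h => hab (Fin.ext h)
  refine params_ext ?_ rfl fun i hi => ?_
  · simp only [hh_one_linSigma, hh_two_linSigma, kk_linSigma]
    simp
    ring
  · simp only [hh_two_linSigma, kk_linSigma]
    split_ifs <;> ring

theorem isOpenMap_linSigma {a b : Fin n} (hab : a ≠ b) : IsOpenMap (linSigma a b) :=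
  isOpenMap_of_involutive (continuous_linSigma a b) (linSigma_involutive hab)

/-- For `i ≠ a, b` the values of `h` and of the argument coincide. For the `x` coordinates with `i =
a` or `i = b`, and for the `y` coordinates at these indices, the arguments differ by the reflection
`k ↦ h - k`, which preserves the cross-ratio. -/
theorem sigmaParam_linSigma {a b : Fin n} (hab : a ≠ b) (p : Params n) :
    sigmaParam br b (linSigma a b p) = sigmaParam br a p := by
  have hab' : a.val ≠ b.val := fun h => hab (Fin.ext h)
  have symm := fun k₁ k₂ k₃ h k => crossRatio_sub (f := br.fn) br.fn_neg k₁ k₂ k₃ h k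
  have e1 : kk (linSigma a b p) 1 = kk p 1 := by rw [kk_linSigma, if_neg (by omega)]
  have e2 : kk (linSigma a b p) 2 = kk p 2 := by rw [kk_linSigma, if_neg (by omega)]
  have e3 : kk (linSigma a b p) 3 = kk p 3 := by rw [kk_linSigma, if_neg (by omega)]
  have ea : kk (linSigma a b p) (a.val + 4) = hh p 2 - kk p (a.val + 4) := by
    rw [kk_linSigma, if_pos (by omega)]
  have eb : kk (linSigma a b p) (b.val + 4) = hh p 2 - kk p (b.val + 4) := by
    rw [kk_linSigma, if_pos (by omega)]
  funext v
  rcases v with i | i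
  · simp only [sigmaParam, param_inl, e1, e2, e3, eb, hh_one_linSigma, hh_two_linSigma]
    by_cases hib : i = b
    · subst hib
      rw [if_pos rfl, if_neg hab.symm, ← symm]
      congr 1
      ring
    rw [if_neg hib]
    by_cases hia : i = a
    · subst hia
      rw [if_pos rfl, ea, ← symm _ _ _ (hh p 1)]
      congr 1 <;> ring
    · have hi1 : i.val ≠ a.val := fun h => hia (Fin.ext h)
      have hi2 : i.val ≠ b.val := fun h => hib (Fin.ext h)
      rw [if_neg hia, kk_linSigma, if_neg (by omega)]
      congr 1 <;> ring
  · simp only [sigmaParam, param_inr, e1, e2, e3, hh_two_linSigma, kk_linSigma]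
    split_ifs
    · rw [symm]
    · rfl

/-- After `σ_a` the point is also the `σ_b`-image of the point with parameters `linSigma a b p`, and
the involution `σ_b` undoes that step. -/
theorem genericallyMaps_sigma_mul_sigma {a b : Fin n} (hab : a ≠ b) :
    GenericallyMaps br (sigma a * sigma b) (linSigma a b) := by
  have hg := generic_good (n := n) br
  refine (hg.and (hg.comp (continuous_linSigma a b) (isOpenMap_linSigma hab))).mono fun p hp => ?_
  refine (hp.1.mapsPoint_sigma a).mul ?_
  rw [← sigmaParam_linSigma br hab]
  exact hp.2.mapsPoint_sigma' b

/-! ### The maps `t` -/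

theorem isOpenMap_of_linear_involutive {T : Params n →ₗ[ℂ] Params n}
    (hT : Function.Involutive T) : IsOpenMap T :=
  isOpenMap_of_involutive T.continuous_of_finiteDimensional hT

theorem involutive_lin₁ : Function.Involutive (lin₁ n) := fun _ =>
  params_ext rfl rfl fun _ _ => rfl

theorem genericallyMaps_omega : GenericallyMaps br (omega n) (lin₁ n) := by
  refine ⟨univ, isOpen_univ, dense_univ, fun p _ => ?_⟩
  have e : param br (lin₁ n p) = fun v => param br p v.swap := by
    funext v
    rcases v with i | i <;> rfl
  change MapsPoint _ _ _
  rw [e]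
  exact mapsPoint_omega _

theorem compatible_t₁ : Compatible br (t₁ n) (lin₁ n) :=
  (genericallyMaps_omega br).compatible (isOpenMap_of_linear_involutive involutive_lin₁)

/-! ### The map `t_2`. -/

section T2
variable (hn : 1 < n) (p : Params n)

/-- The parameter `β` in the action of `t_2`. -/
noncomputable def shift : ℂ := hh p 1 + hh p 2 - kk p 1 - kk p 2 - kk p 3 - kk p 4

theorem hh_lin₂ (s : ℕ) (hs : 1 ≤ s ∧ s ≤ 2) :
    hh (lin₂ n hn p) s hs = hh p s hs + shift hn p := rfl

theorem kk_lin₂ (i : ℕ) (hi : 1 ≤ i ∧ i ≤ n + 3) : kk (lin₂ n hn p) i hi =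
    if i ≤ 4 then kk p i hi + shift hn p else kk p i hi := by
  obtain ⟨i, rfl⟩ : ∃ j, i = j + 1 := ⟨i - 1, by omega⟩
  rfl

theorem involutive_lin₂ : Function.Involutive (lin₂ n hn) := by
  intro p
  have e : shift hn (lin₂ n hn p) = -shift hn p := by
    rw [shift]
    simp only [hh_lin₂, kk_lin₂]
    simp only [shift]
    norm_num
    ring
  refine params_ext ?_ ?_ fun i hi => ?_
  · rw [hh_lin₂, e, hh_lin₂]; ring
  · rw [hh_lin₂, e, hh_lin₂]; ring
  · rw [kk_lin₂, e, kk_lin₂]; split_ifs <;> ring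

/-- The choice of `β` turns each `[h₁ - k_i - k_j - β]` into minus the bracket of `h₂` with the
complementary pair of indices. Complementary pairs lie together in the numerator or together in the
denominator. -/
theorem crossRatio_shift {f : ℂ → ℂ} (odd : ∀ u, f (-u) = -f u) (h₁ h₂ k₁ k₂ k₃ k₄ : ℂ) {β : ℂ}
    (hβ : β = h₁ + h₂ - k₁ - k₂ - k₃ - k₄) :
    crossRatio f (k₁ + β) (k₂ + β) (k₃ + β) (h₁ + β) (k₄ + β) = crossRatio f k₁ k₂ k₃ h₂ k₄ := by
  have e : ∀ h x y, pair f (h + β) (x + β) (y + β) = f (x - y) * f (h - x - y - β) := by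
    intro h x y
    rw [pair]
    congr 2 <;> ring
  simp only [crossRatio, e]
  rw [show h₁ - k₁ - k₃ - β = -(h₂ - k₂ - k₄) by rw [hβ]; ring,
    show h₁ - k₂ - k₄ - β = -(h₂ - k₁ - k₃) by rw [hβ]; ring,
    show h₁ - k₂ - k₃ - β = -(h₂ - k₁ - k₄) by rw [hβ]; ring,
    show h₁ - k₁ - k₄ - β = -(h₂ - k₂ - k₃) by rw [hβ]; ring]
  simp only [odd, pair]
  congr 1 <;> ring

/-- Here `β` makes the two kinds of brackets trade places: `[h - k_i - k_j]` on one side is a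
difference `[k_i - k]` on the other. -/
theorem crossRatio_shift' {f : ℂ → ℂ} (h₁ h₂ k₁ k₂ k₃ k₄ k : ℂ) {β : ℂ}
    (hβ : β = h₁ + h₂ - k₁ - k₂ - k₃ - k₄) :
    crossRatio f (k₁ + β) (k₂ + β) (k₃ + β) (h₁ + β + (h₂ + β) - (k₄ + β) - k)
      (h₁ + β - (k₄ + β)) = crossRatio f k₁ k₂ k₃ h₂ k := by
  simp only [crossRatio, pair]
  congr 1
  · rw [show k₁ + β - (k₃ + β) = k₁ - k₃ by ring,
      show h₁ + β + (h₂ + β) - (k₄ + β) - k - (k₁ + β) - (k₃ + β) = k₂ - k by rw [hβ]; ring,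
      show k₂ + β - (h₁ + β - (k₄ + β)) = h₂ - k₁ - k₃ by rw [hβ]; ring,
      show h₁ + β + (h₂ + β) - (k₄ + β) - k - (k₂ + β) - (h₁ + β - (k₄ + β)) = h₂ - k₂ - k by ring]
    ring
  · rw [show k₂ + β - (k₃ + β) = k₂ - k₃ by ring,
      show h₁ + β + (h₂ + β) - (k₄ + β) - k - (k₂ + β) - (k₃ + β) = k₁ - k by rw [hβ]; ring,
      show k₁ + β - (h₁ + β - (k₄ + β)) = h₂ - k₂ - k₃ by rw [hβ]; ring,
      show h₁ + β + (h₂ + β) - (k₄ + β) - k - (k₁ + β) - (h₁ + β - (k₄ + β)) = h₂ - k₁ - k by ring]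
    ring

theorem sigmaParam_lin₂_inl (i : Fin n) : sigmaParam br ⟨0, by omega⟩ (lin₂ n hn p) (Sum.inl i) =
    sigmaParam br ⟨0, by omega⟩ p (Sum.inr i) := by
  have e1 : kk (lin₂ n hn p) 1 = kk p 1 + shift hn p := rfl
  have e2 : kk (lin₂ n hn p) 2 = kk p 2 + shift hn p := rfl
  have e3 : kk (lin₂ n hn p) 3 = kk p 3 + shift hn p := rfl
  have e4 : kk (lin₂ n hn p) (0 + 4) = kk p 4 + shift hn p := rfl
  by_cases hi : i = ⟨0, by omega⟩
  · subst hi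
    rw [sigmaParam, if_pos rfl, sigmaParam, param_inl, param_inr, e1, e2, e3, hh_lin₂]
    exact crossRatio_shift br.fn_neg _ _ _ _ _ _ rfl
  · have hi' : i.val ≠ 0 := fun h => hi (Fin.ext h)
    rw [sigmaParam, if_neg hi, sigmaParam, param_inr, e1, e2, e3, e4, hh_lin₂, hh_lin₂,
      kk_lin₂ hn p (i.val + 4), if_neg (by omega)]
    exact crossRatio_shift' _ _ _ _ _ _ _ rfl

theorem sigmaParam_lin₂ (v : Vars n) : sigmaParam br ⟨0, by omega⟩ (lin₂ n hn p) v =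
    sigmaParam br ⟨0, by omega⟩ p v.swap := by
  rcases v with i | i
  · exact sigmaParam_lin₂_inl br hn p i
  · have := sigmaParam_lin₂_inl br hn (lin₂ n hn p) i
    rw [involutive_lin₂] at this
    exact this.symm

theorem compatible_t₂ : Compatible br (t₂ n hn) (lin₂ n hn) := by
  have hg := generic_good (n := n) br
  have ho := isOpenMap_of_linear_involutive (involutive_lin₂ hn)
  have hc : Continuous (lin₂ n hn) := LinearMap.continuous_of_finiteDimensional _
  refine GenericallyMaps.compatible ((hg.and (hg.comp hc ho)).mono fun p hp => ?_) ho
  refine ((hp.1.mapsPoint_sigma _).mul (mapsPoint_omega _)).mul ?_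
  rw [← funext (sigmaParam_lin₂ br hn p)]
  exact hp.2.mapsPoint_sigma' _

end T2

/-- The action of `ω` and of the products `σ_a σ_b` on the parameters, composed. -/
theorem genericallyMaps_omega_mul {a b : Fin n} (hab : a ≠ b) {τ : RatFn n ≃ₐ[ℂ] RatFn n}
    {T : Params n → Params n} (h : GenericallyMaps br τ T) :
    GenericallyMaps br (omega n * (sigma a * sigma b * τ)) ((T ∘ linSigma a b) ∘ lin₁ n) := by
  have h1 := (genericallyMaps_sigma_mul_sigma br hab).mul h (continuous_linSigma a b)
    (isOpenMap_linSigma hab)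
  have hc : Continuous (lin₁ n) := LinearMap.continuous_of_finiteDimensional _
  exact (genericallyMaps_omega br).mul h1 hc (isOpenMap_of_linear_involutive involutive_lin₁)

theorem hh_one_lin₁ (p : Params n) : hh (lin₁ n p) 1 = hh p 2 := rfl

theorem hh_two_lin₁ (p : Params n) : hh (lin₁ n p) 2 = hh p 1 := rfl

theorem kk_lin₁ (p : Params n) (i : ℕ) (hi : 1 ≤ i ∧ i ≤ n + 3) :
    kk (lin₁ n p) i hi = kk p i hi := rfl

/-! ### The map `t_3`. -/

section T3
variable (hn : 1 < n) (p : Params n)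

theorem hh_one_lin₃ : hh (lin₃ n hn p) 1 = hh p 1 + hh p 2 - kk p 4 - kk p 5 := rfl

theorem hh_two_lin₃ : hh (lin₃ n hn p) 2 = hh p 2 := rfl

theorem kk_lin₃ (i : ℕ) (hi : 1 ≤ i ∧ i ≤ n + 3) : kk (lin₃ n hn p) i hi =
    if i = 4 then hh p 2 - kk p 5 else if i = 5 then hh p 2 - kk p 4 else kk p i hi := by
  obtain ⟨i, rfl⟩ : ∃ j, i = j + 1 := ⟨i - 1, by omega⟩
  rfl

theorem involutive_lin₃ : Function.Involutive (lin₃ n hn) := by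
  intro p
  refine params_ext ?_ rfl fun i hi => ?_
  · simp only [hh_one_lin₃, hh_two_lin₃, kk_lin₃]
    norm_num
    ring
  · simp only [hh_two_lin₃, kk_lin₃]
    norm_num
    split_ifs with h1 h2
    · subst h1; rfl
    · subst h2; rfl
    · rfl

theorem compatible_t₃ : Compatible br (t₃ n hn) (lin₃ n hn) := by
  have h01 : (⟨0, by omega⟩ : Fin n) ≠ ⟨1, hn⟩ := by simp
  have h := genericallyMaps_omega_mul br h01
    (genericallyMaps_omega_mul br h01.symm (genericallyMaps_omega br))
  refine GenericallyMaps.compatible ?_ (isOpenMap_of_linear_involutive (involutive_lin₃ hn))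
  -- The word is bracketed so that the `σ` occur only in pairs, each of which acts linearly on the
  -- parameters.
  have et : t₃ n hn = omega n * (sigma ⟨0, by omega⟩ * sigma ⟨1, hn⟩ *
      (omega n * (sigma ⟨1, hn⟩ * sigma ⟨0, by omega⟩ * omega n))) := by
    simp only [t₃, mul_assoc]
  rw [et]
  refine h.mono fun p hp => ?_
  convert hp using 2
  refine params_ext ?_ ?_ fun i hi => ?_
  · simp only [Function.comp_apply, hh_one_lin₁, hh_two_lin₁, hh_two_linSigma, hh_one_linSigma,
      kk_lin₁, hh_one_lin₃]
    norm_num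
    ring
  · simp only [Function.comp_apply, hh_one_lin₁, hh_two_lin₁, hh_two_linSigma, hh_one_linSigma,
      kk_lin₁, kk_linSigma, hh_two_lin₃]
    norm_num
  · simp only [Function.comp_apply, hh_one_lin₁, hh_two_lin₁, hh_one_linSigma,
      kk_lin₁, kk_linSigma, kk_lin₃]
    by_cases h4 : i = 4
    · subst h4
      norm_num
      ring
    by_cases h5 : i = 5
    · subst h5
      norm_num
      ring
    simp [h4, h5]

end T3

/-! ### The maps `t_{i+3}`. -/

section TAdd3
variable (i : ℕ) (hi : 1 ≤ i) (hin : i < n) (p : Params n)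

theorem hh_linAdd3 (s : ℕ) (hs : 1 ≤ s ∧ s ≤ 2) : hh (linAdd3 n i hi hin p) s hs = hh p s hs := rfl

theorem kk_linAdd3 (l : ℕ) (hl : 1 ≤ l ∧ l ≤ n + 3) : kk (linAdd3 n i hi hin p) l hl =
    if l = i + 3 then kk p (i + 4) else if l = i + 4 then kk p (i + 3) else kk p l hl := by
  obtain ⟨l, rfl⟩ : ∃ j, l = j + 1 := ⟨l - 1, by omega⟩
  rfl

theorem involutive_linAdd3 : Function.Involutive (linAdd3 n i hi hin) := by
  intro p
  refine params_ext rfl rfl fun l hl => ?_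
  simp only [kk_linAdd3]
  simp
  split_ifs with h1 h2
  · subst h1; rfl
  · subst h2; rfl
  · rfl

theorem compatible_tAdd3 : Compatible br (tAdd3 n i hi hin) (linAdd3 n i hi hin) := by
  -- From here on `i` is the former index minus one, so the two exchanged parameters are `k_{i+4}`
  -- and `k_{i+5}`.
  obtain ⟨i, rfl⟩ : ∃ j, i = j + 1 := ⟨i - 1, by omega⟩
  have hab : (⟨i + 1 - 1, by omega⟩ : Fin n) ≠ ⟨i + 1, hin⟩ := by simp
  have h := genericallyMaps_omega_mul br hab (genericallyMaps_omega_mul br hab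
    ((genericallyMaps_omega br).mul (genericallyMaps_sigma_mul_sigma br hab)
      (LinearMap.continuous_of_finiteDimensional _)
      (isOpenMap_of_linear_involutive involutive_lin₁)))
  refine GenericallyMaps.compatible ?_
    (isOpenMap_of_linear_involutive (involutive_linAdd3 _ hi hin))
  have et : tAdd3 n (i + 1) hi hin = omega n * (sigma ⟨i + 1 - 1, by omega⟩ * sigma ⟨i + 1, hin⟩ *
      (omega n * (sigma ⟨i + 1 - 1, by omega⟩ * sigma ⟨i + 1, hin⟩ *
        (omega n * (sigma ⟨i + 1 - 1, by omega⟩ * sigma ⟨i + 1, hin⟩))))) := by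
    simp only [tAdd3, pow_succ, pow_zero, one_mul, mul_assoc]
  rw [et]
  refine h.mono fun p hp => ?_
  convert hp using 2
  refine params_ext ?_ ?_ fun l hl => ?_
  · simp only [Function.comp_apply, hh_one_lin₁, hh_two_lin₁, hh_two_linSigma, hh_one_linSigma,
      kk_lin₁, kk_linSigma, hh_linAdd3]
    simp
    ring
  · simp only [Function.comp_apply, hh_one_lin₁, hh_two_lin₁, hh_two_linSigma, hh_one_linSigma,
      kk_lin₁, kk_linSigma, hh_linAdd3]
    simp
    ring
  · simp only [Function.comp_apply, hh_one_lin₁, hh_two_lin₁, hh_two_linSigma, hh_one_linSigma,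
      kk_lin₁, kk_linSigma, kk_linAdd3]
    by_cases h4 : l = i + 4
    · subst h4
      simp
      ring
    by_cases h5 : l = i + 5
    · subst h5
      simp
      ring
    have h5' : l ≠ i + 1 + 4 := h5
    simp [h4, h5']

end TAdd3

end TripletPair

theorem mainTheorem1 (br : TripletPair.Bracket) (m n : ℕ) (hm : 1 < m) (hmn : m ≤ n) :
    TripletPair.Compatible br (TripletPair.t₁ n) (TripletPair.lin₁ n) ∧
    TripletPair.Compatible br (TripletPair.t₂ n (hm.trans_le hmn))
      (TripletPair.lin₂ n (hm.trans_le hmn)) ∧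
    TripletPair.Compatible br (TripletPair.t₃ n (hm.trans_le hmn))
      (TripletPair.lin₃ n (hm.trans_le hmn)) ∧
    ∀ (i : ℕ) (hi : 1 ≤ i) (him : i < m),
      TripletPair.Compatible br (TripletPair.tAdd3 n i hi (him.trans_le hmn))
        (TripletPair.linAdd3 n i hi (him.trans_le hmn)) :=
  ⟨TripletPair.compatible_t₁ br, TripletPair.compatible_t₂ br _, TripletPair.compatible_t₃ br _,
    fun i hi _ => TripletPair.compatible_tAdd3 br i hi _⟩
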